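/- Let $M$ be a (Hausdorff, finite-dimensional) $C^\infty$ manifold with a $C^\infty$ affine connection $\nabla$ (possibly with torsion). Let $\gamma : I \to M$ be a $C^\infty$ curve on an open interval $I$, let $t_0 \in I$ and let $k \ge 1$ be an integer. Put $\nabla^1\gamma = \gamma'$ and $\nabla^{i+1}\gamma = \nabla^\gamma_{\partial/\partial t}(\nabla^i\gamma)$ for $i \ge 1$, where $\nabla^\gamma_{\partial/\partial t}$ is the covariant derivative of vector fields along $\gamma$. Suppose that $(\nabla^i\gamma)(t_0) = 0$ for $1 \le i < k$ and that $(\nabla^k\gamma)(t_0), (\nabla^{k+1}\gamma)(t_0)$ are linearly independent. Then $\gamma$ is directed near $t_0$: there is an open interval $J$ with $t_0 \in J \subseteq I$ and a $C^\infty$ vector field $u$ along $\gamma|_J$ with $u(t) \ne 0$ and $\gamma'(t) \in \langle u(t)\rangle_{\mathbf R}$ for all $t \in J$ (a frame). Moreover, for every such frame $u$ on a neighbourhood of $t_0$, the $\nabla$-tangent surface $$f(t,s) = \varphi(\gamma(t), u(t), s),$$ where $s \mapsto \varphi(x,v,s)$ is the $\nabla$-geodesic with $\varphi(x,v,0)=x$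 and $\frac{\partial\varphi}{\partial s}(x,v,0)=v$, has the following properties. (a) The germ of $f$ at $(t_0,0)$ is a frontal with a non-degenerate singular point at $(t_0,0)$: on a neighbourhood $U$ of $(t_0,0)$ the map $f$ is defined and $C^\infty$, and there are $C^\infty$ vector fields $V_1, V_2$ along $f|_U$, linearly independent at each point, with $f_*(T_q\mathbf R^2) \subseteq \langle V_1(q), V_2(q)\rangle_{\mathbf R}$ for all $q \in U$, such that the $C^\infty$ function $\sigma$ on $U$ determined by $\frac{\partial f}{\partial t}\wedge\frac{\partial f}{\partial s} = \sigma\, V_1 \wedge V_2$ satisfies $\sigma(t_0,0) = 0$ and $d\sigma(t_0,0) \ne 0$. (b) The singular locus $S(f)$, the set of points at which $f$ is not an immersion, coincides with $\{s = 0\}$ on a neighbourhood of $(t_0,0)$. -/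

import Mathlib

open scoped Manifold ContDiff Topology

noncomputable section

namespace TangentSurface

variable {E : Type*} [NormedAddCommGroup E] [NormedSpace ℝ E]
  {M : Type*} [TopologicalSpace M] [ChartedSpace E M] [IsManifold 𝓘(ℝ, E) ∞ M]

/-- An affine connection on `M`: a covariant derivative on the tangent bundle of `M`. In Mathlib's
argument order `cov X x v` is the vector `(∇_v X)(x)`. -/
abbrev AffineConnection (E : Type*) [NormedAddCommGroup E] [NormedSpace ℝ E]
    (M : Type*) [TopologicalSpace M] [ChartedSpace E M] [IsManifold 𝓘(ℝ, E) ∞ M] :=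
  CovariantDerivative 𝓘(ℝ, E) E (TangentSpace 𝓘(ℝ, E) : M → Type _)

/-- The velocity vector `γ'(t) ∈ T_{γ(t)} M` of a curve. -/
def velocity (γ : ℝ → M) (t : ℝ) : TangentSpace 𝓘(ℝ, E) (γ t) :=
  mfderiv 𝓘(ℝ, ℝ) 𝓘(ℝ, E) γ t (1 : ℝ)

/-- The local vector field with constant components `e` in the coordinates of the preferred chart
at `x₀`, that is `∑ eⁱ ∂/∂xⁱ`. (It is set to `0` outside the domain of the chart.) -/
def coordField (x₀ : M) (e : E) (x : M) : TangentSpace 𝓘(ℝ, E) x :=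
  (trivializationAt E (TangentSpace 𝓘(ℝ, E) : M → Type _) x₀).symm x e

/-- The components, in the coordinates of the preferred chart at `x₀`, of a tangent vector. -/
def coordComponents (x₀ : M) {x : M} (v : TangentSpace 𝓘(ℝ, E) x) : E :=
  (trivializationAt E (TangentSpace 𝓘(ℝ, E) : M → Type _) x₀
    (⟨x, v⟩ : TangentBundle 𝓘(ℝ, E) M)).2

/-- The covariant derivative `∇^γ_{∂/∂t} w` of a vector field `w` along a curve `γ`, at the time
`t`, computed in the coordinates of the preferred chart at `x₀` (whose domain has to contain
`γ(t)`): writing `w = ∑ wⁱ ∂ᵢ`, it is `∑ (dwⁱ/dt) ∂ᵢ + ∑ wⁱ(t) ∇_{γ'(t)} ∂ᵢ`, that is, the vector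
with the components `dw^λ/dt + Γ^λ_{μν} (γ')^μ w^ν`. -/
def covDerivAlongInChart (cov : AffineConnection E M) (x₀ : M) (γ : ℝ → M)
    (w : ∀ t : ℝ, TangentSpace 𝓘(ℝ, E) (γ t)) (t : ℝ) : TangentSpace 𝓘(ℝ, E) (γ t) :=
  coordField x₀ (deriv (fun τ : ℝ => coordComponents x₀ (w τ)) t) (γ t)
    + cov (coordField x₀ (coordComponents x₀ (w t))) (γ t) (velocity γ t)

/-- The covariant derivative `∇^γ_{∂/∂t} w` of a vector field `w` along a curve `γ`. It does not
depend on the coordinates; those of the preferred chart at `γ(t)` are used at the time `t`. -/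
def covDerivAlong (cov : AffineConnection E M) (γ : ℝ → M)
    (w : ∀ t : ℝ, TangentSpace 𝓘(ℝ, E) (γ t)) (t : ℝ) : TangentSpace 𝓘(ℝ, E) (γ t) :=
  covDerivAlongInChart cov (γ t) γ w t

/-- The iterated covariant derivatives `∇^k γ` of a curve: `∇^1 γ = γ'` and
`∇^{k+1} γ = ∇^γ_{∂/∂t} (∇^k γ)` for `k ≥ 1`. (The index `0` is not used; its value is `0`.) -/
def iterNabla (cov : AffineConnection E M) (γ : ℝ → M) :
    ℕ → ∀ t : ℝ, TangentSpace 𝓘(ℝ, E) (γ t)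
  | 0 => fun _ => 0
  | 1 => velocity γ
  | k + 2 => covDerivAlong cov γ (iterNabla cov γ (k + 1))

/-- `c` is a `∇`-geodesic on the set `J` (an open interval): it is smooth and `∇² c = 0` there. -/
def IsGeodesicOn (cov : AffineConnection E M) (c : ℝ → M) (J : Set ℝ) : Prop :=
  ContMDiffOn 𝓘(ℝ, ℝ) 𝓘(ℝ, E) ∞ c J ∧ ∀ s ∈ J, iterNabla cov c 2 s = 0

/-- `y` is reached at time `s` by a `∇`-geodesic, defined on an open interval containing `0` and
`s`, which starts at time `0` at the point and with the velocity prescribed by `p = (x, v)`. -/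
def GeodesicReaches (cov : AffineConnection E M) (p : TangentBundle 𝓘(ℝ, E) M) (s : ℝ) (y : M) :
    Prop :=
  ∃ (c : ℝ → M) (J : Set ℝ), IsOpen J ∧ J.OrdConnected ∧ (0 : ℝ) ∈ J ∧ s ∈ J ∧
    IsGeodesicOn cov c J ∧ (⟨c 0, velocity c 0⟩ : TangentBundle 𝓘(ℝ, E) M) = p ∧ c s = y

open Classical in
/-- The family of geodesics `φ(x, v, s)`, with `p = (x, v)`: the point at time `s` of the geodesic
through `x` with the velocity `v` at `s = 0`. Where the geodesic does not exist up to the time `s`,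
the value is set to `x`. -/
def geodesicFamily (cov : AffineConnection E M) (p : TangentBundle 𝓘(ℝ, E) M) (s : ℝ) : M :=
  if h : ∃ y, GeodesicReaches cov p s y then h.choose else p.1

/-- `u` is a frame of a directed structure of the curve `γ` over `J`: a smooth nowhere vanishing
vector field along `γ` such that `γ'(t)` lies in the line spanned by `u(t)`. -/
structure IsDirectedFrameOn (γ : ℝ → M) (u : ∀ t : ℝ, TangentSpace 𝓘(ℝ, E) (γ t))
    (J : Set ℝ) : Prop where
  smooth : ContMDiffOn 𝓘(ℝ, ℝ) 𝓘(ℝ, E).tangent ∞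
    (fun t : ℝ => (⟨γ t, u t⟩ : TangentBundle 𝓘(ℝ, E) M)) J
  ne_zero : ∀ t ∈ J, u t ≠ 0
  integral : ∀ t ∈ J, ∃ a : ℝ, velocity γ t = a • u t

/-- The `∇`-tangent surface `(t, s) ↦ φ(γ(t), u(t), s)` of the curve `γ` directed by `u`. -/
def tangentSurface (cov : AffineConnection E M) (γ : ℝ → M)
    (u : ∀ t : ℝ, TangentSpace 𝓘(ℝ, E) (γ t)) (q : ℝ × ℝ) : M :=
  geodesicFamily cov ⟨γ q.1, u q.1⟩ q.2

/-- The differential `f_* : T_q ℝ² → T_{f(q)} M`. -/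
def surfaceDeriv (f : ℝ × ℝ → M) (q : ℝ × ℝ) : (ℝ × ℝ) →L[ℝ] TangentSpace 𝓘(ℝ, E) (f q) :=
  mfderiv 𝓘(ℝ, ℝ × ℝ) 𝓘(ℝ, E) f q

/-- `V₁, V₂` is a smooth frame over `U` of an integral lifting of `f` to the Grassmannian bundle of
`2`-planes in `TM`: the lifting is `q ↦ ⟨V₁(q), V₂(q)⟩ ⊂ T_{f(q)} M`, and integrality says that the
image of the differential of `f` at `q` is contained in this plane. -/
structure IsIntegralFrameOn (f : ℝ × ℝ → M) (V₁ V₂ : ∀ q : ℝ × ℝ, TangentSpace 𝓘(ℝ, E) (f q))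
    (U : Set (ℝ × ℝ)) : Prop where
  smooth₁ : ContMDiffOn 𝓘(ℝ, ℝ × ℝ) 𝓘(ℝ, E).tangent ∞
    (fun q : ℝ × ℝ => (⟨f q, V₁ q⟩ : TangentBundle 𝓘(ℝ, E) M)) U
  smooth₂ : ContMDiffOn 𝓘(ℝ, ℝ × ℝ) 𝓘(ℝ, E).tangent ∞
    (fun q : ℝ × ℝ => (⟨f q, V₂ q⟩ : TangentBundle 𝓘(ℝ, E) M)) U
  linearIndependent : ∀ q ∈ U, LinearIndependent ℝ ![V₁ q, V₂ q]
  integral : ∀ q ∈ U, ∀ ξ : ℝ × ℝ, surfaceDeriv f q ξ ∈ Submodule.span ℝ {V₁ q, V₂ q}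

/-- `σ` is the signed area density of `f` over `U` with respect to the frame `V₁, V₂`:
`∂f/∂t ∧ ∂f/∂s = σ V₁ ∧ V₂`. -/
def IsAreaDensityOn (f : ℝ × ℝ → M) (V₁ V₂ : ∀ q : ℝ × ℝ, TangentSpace 𝓘(ℝ, E) (f q))
    (σ : ℝ × ℝ → ℝ) (U : Set (ℝ × ℝ)) : Prop :=
  ∀ q ∈ U,
    ExteriorAlgebra.ιMulti ℝ 2 ![surfaceDeriv f q (1, 0), surfaceDeriv f q (0, 1)]
      = σ q • ExteriorAlgebra.ιMulti ℝ 2 ![V₁ q, V₂ q]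

/-- The germ of `f` at `p` is a frontal, i.e. near `p` the map `f` is smooth and has a smooth integral
lifting to the Grassmannian bundle of `2`-planes in `TM`, and `p` is a non-degenerate singular point
of it, i.e. for a frame of the lifting the signed area density `σ` satisfies `σ(p) = 0` and `dσ(p) ≠ 0`. (If this holds for one
frame of one integral lifting, then it holds for all of them.) -/
def IsFrontalWithNondegenerateSingularPointAt (f : ℝ × ℝ → M) (p : ℝ × ℝ) : Prop :=
  ∃ U : Set (ℝ × ℝ), IsOpen U ∧ p ∈ U ∧ ContMDiffOn 𝓘(ℝ, ℝ × ℝ) 𝓘(ℝ, E) ∞ f U ∧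
    ∃ V₁ V₂ : ∀ q : ℝ × ℝ, TangentSpace 𝓘(ℝ, E) (f q), IsIntegralFrameOn f V₁ V₂ U ∧
      ∃ σ : ℝ × ℝ → ℝ, ContDiffOn ℝ ∞ σ U ∧ IsAreaDensityOn f V₁ V₂ σ U ∧
        σ p = 0 ∧ fderiv ℝ σ p ≠ 0

/-- The singular locus `S(f)`: the set of points where `f` is not an immersion. -/
def singularLocus (f : ℝ × ℝ → M) : Set (ℝ × ℝ) :=
  {q | ¬ Function.Injective (surfaceDeriv (E := E) f q)}

end TangentSurface

end

/-! Near `t₀` everything can be read in a chart, where covariant differentiation along `γ` is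
`v ↦ v' + B v` for a smooth family `B` of endomorphisms. The vanishing of the first `k - 1`
derivatives of `γ` gives `γ' = (t - t₀) ^ (k - 1) • v` with `v` smooth (Hadamard division), and
the `k`-th and `(k + 1)`-st derivatives at `t₀` are then, up to nonzero factors and a multiple of
`v`, equal to `v` and `∇v`; so `v` is a frame with `v`, `∇v` independent at `t₀`. Any other frame
`u` is a smooth nonvanishing multiple of `v` near `t₀`, hence `u`, `∇u` are independent as well.

Geodesics depend smoothly on their initial data, so `f` and `V = ∂f/∂s` are smooth. Writing
`γ' = a u`, the field `∂f/∂t - a V` vanishes on `s = 0` and is therefore `s W` with `W` smooth, and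
`W (t, 0) = ∇u (t)`. Thus `W`, `V` is a frame of the tangent planes near `(t₀, 0)`, and
`∂f/∂t ∧ ∂f/∂s = (a V + s W) ∧ V = s (W ∧ V)`, that is `σ = s`. -/

noncomputable section

namespace TangentSurface

/-! ### Superposition operators on spaces of continuous maps -/

section Superposition

open Classical in
/-- The superposition operator `α ↦ f ∘ α`, set to `0` where `f ∘ α` is not continuous. -/
def superpose {K F G : Type*} [TopologicalSpace K] [TopologicalSpace F] [TopologicalSpace G]
    [Zero G] (f : F → G) (α : C(K, F)) : C(K, G) :=
  if h : Continuous (fun τ => f (α τ)) then ⟨fun τ => f (α τ), h⟩ else 0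

lemma superpose_apply {K F G : Type*} [TopologicalSpace K] [TopologicalSpace F]
    [TopologicalSpace G] [Zero G] {f : F → G} {Ω : Set F} (hf : ContinuousOn f Ω) {α : C(K, F)}
    (hα : ∀ τ, α τ ∈ Ω) (τ : K) : superpose f α τ = f (α τ) := by
  have h : Continuous (fun τ => f (α τ)) := hf.comp_continuous α.continuous hα
  simp [superpose, h]

lemma isOpen_forall_mem {K F : Type*} [TopologicalSpace K] [CompactSpace K] [TopologicalSpace F]
    {Ω : Set F} (hΩ : IsOpen Ω) : IsOpen {α : C(K, F) | ∀ τ, α τ ∈ Ω} := by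
  simpa [Set.MapsTo] using ContinuousMap.isOpen_setOfPred_mapsTo (X := K) isCompact_univ hΩ

/-- Pointwise application of a continuous family of operators to a continuous family of vectors,
as a continuous bilinear map. -/
def pointwiseApply (K F G : Type*) [TopologicalSpace K] [CompactSpace K]
    [NormedAddCommGroup F] [NormedSpace ℝ F] [NormedAddCommGroup G] [NormedSpace ℝ G] :
    C(K, F →L[ℝ] G) →L[ℝ] C(K, F) →L[ℝ] C(K, G) :=
  LinearMap.mkContinuous₂
    (LinearMap.mk₂ ℝ (fun (A : C(K, F →L[ℝ] G)) (β : C(K, F)) =>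
        (⟨fun τ => A τ (β τ), A.continuous.clm_apply β.continuous⟩ : C(K, G)))
      (fun A B β => by ext; simp) (fun c A β => by ext; simp)
      (fun A β β' => by ext; simp) (fun c A β => by ext; simp)) 1
    (fun A β => by
      rw [one_mul, ContinuousMap.norm_le _ (by positivity)]
      exact fun τ => (A τ).le_of_opNorm_le_of_le (A.norm_coe_le_norm τ) (β.norm_coe_le_norm τ))

variable {K F G : Type*} [TopologicalSpace K] [CompactSpace K]
  [NormedAddCommGroup F] [NormedSpace ℝ F] [NormedAddCommGroup G] [NormedSpace ℝ G]

lemma pointwiseApply_apply (A : C(K, F →L[ℝ] G)) (β : C(K, F)) (τ : K) :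
    pointwiseApply K F G A β τ = A τ (β τ) := rfl

lemma eventually_forall_add_mem_and_norm_sub_lt {K F G : Type*} [TopologicalSpace K]
    [CompactSpace K] [SeminormedAddCommGroup F] [SeminormedAddCommGroup G]
    {g : F → G} {Ω : Set F} (hΩ : IsOpen Ω) (hg : ContinuousOn g Ω) {α : C(K, F)}
    (hα : ∀ τ, α τ ∈ Ω) {ε : ℝ} (hε : 0 < ε) :
    ∀ᶠ h : F in 𝓝 0, ∀ τ, α τ + h ∈ Ω ∧ ‖g (α τ + h) - g (α τ)‖ < ε := by
  suffices ∀ᶠ h : F in 𝓝 0, ∀ τ ∈ (Set.univ : Set K),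
      α τ + h ∈ Ω ∧ ‖g (α τ + h) - g (α τ)‖ < ε from this.mono fun h hh τ => hh τ trivial
  refine isCompact_univ.eventually_forall_of_forall_eventually fun τ _ => ?_
  have hΩτ : Ω ∈ 𝓝 (α τ) := hΩ.mem_nhds (hα τ)
  have hshift : ContinuousAt (fun z : F × K => α z.2 + z.1) (0, τ) := by fun_prop
  have hbase : ContinuousAt (fun z : F × K => α z.2) (0, τ) := by fun_prop
  have hdiff : ContinuousAt (fun z : F × K => ‖g (α z.2 + z.1) - g (α z.2)‖) (0, τ) :=
    ((ContinuousAt.comp (f := fun z : F × K => α z.2 + z.1)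
      (by simpa using hg.continuousAt hΩτ) hshift).sub
      (ContinuousAt.comp (f := fun z : F × K => α z.2) (hg.continuousAt hΩτ) hbase)).norm
  exact (hshift.eventually_mem (by simpa using hΩτ)).and
    (hdiff.eventually_lt continuousAt_const (by simpa using hε))

lemma hasFDerivAt_superpose {f : F → G} {Ω : Set F} (hΩ : IsOpen Ω) (hf : ContDiffOn ℝ 1 f Ω)
    {α : C(K, F)} (hα : ∀ τ, α τ ∈ Ω) :
    HasFDerivAt (superpose f : C(K, F) → C(K, G))
      (pointwiseApply K F G (superpose (fderiv ℝ f) α)) α := by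
  have hd : ContinuousOn (fderiv ℝ f) Ω := hf.continuousOn_fderiv_of_isOpen hΩ le_rfl
  rw [hasFDerivAt_iff_isLittleO_nhds_zero, Asymptotics.isLittleO_iff]
  intro ε hε
  obtain ⟨δ, hδ, hball⟩ := Metric.eventually_nhds_iff_ball.mp
    (eventually_forall_add_mem_and_norm_sub_lt hΩ hd hα hε)
  have hnear : ∀ τ, ∀ x ∈ Metric.ball (α τ) δ, x ∈ Ω ∧ ‖fderiv ℝ f x - fderiv ℝ f (α τ)‖ < ε :=
    fun τ x hx => by
      simpa using hball (x - α τ) (by rwa [mem_ball_zero_iff, ← mem_ball_iff_norm]) τ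
  filter_upwards [Metric.ball_mem_nhds (0 : C(K, F)) hδ] with β hβ
  rw [mem_ball_zero_iff] at hβ
  have hsum : ∀ τ, (α + β) τ ∈ Metric.ball (α τ) δ := fun τ => by
    simpa [mem_ball_iff_norm] using (β.norm_coe_le_norm τ).trans_lt hβ
  refine (ContinuousMap.norm_le _ (by positivity)).mpr fun τ => ?_
  rw [ContinuousMap.sub_apply, ContinuousMap.sub_apply,
    superpose_apply hf.continuousOn fun τ => (hnear τ _ (hsum τ)).1,
    superpose_apply hf.continuousOn hα, pointwiseApply_apply, superpose_apply hd hα]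
  have hmean : ‖f ((α + β) τ) - f (α τ) - fderiv ℝ f (α τ) ((α + β) τ - α τ)‖
      ≤ ε * ‖(α + β) τ - α τ‖ :=
    (convex_ball (α τ) δ).norm_image_sub_le_of_norm_fderiv_le' (𝕜 := ℝ)
      (fun x hx => (hf.differentiableOn one_ne_zero).differentiableAt
        (hΩ.mem_nhds (hnear τ x hx).1))
      (fun x hx => (hnear τ x hx).2.le) (Metric.mem_ball_self hδ) (hsum τ)
  rw [ContinuousMap.add_apply, add_sub_cancel_left] at hmean
  exact hmean.trans (by gcongr; exact β.norm_coe_le_norm τ)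

-- The derivative of `f` takes its values in `F →L[ℝ] G`, so the induction on the order of
-- differentiability needs a universe for `G` which is closed under `F →L[ℝ] ·`.
lemma contDiffOn_nat_superpose.{u, v, w} {K : Type w} [TopologicalSpace K] [CompactSpace K]
    {F : Type u} [NormedAddCommGroup F] [NormedSpace ℝ F] {Ω : Set F} (hΩ : IsOpen Ω)
    (n : ℕ) :
    ∀ {G : Type max u v} [NormedAddCommGroup G] [NormedSpace ℝ G] {f : F → G},
      ContDiffOn ℝ ∞ f Ω →
        ContDiffOn ℝ n (superpose f : C(K, F) → C(K, G)) {α | ∀ τ, α τ ∈ Ω} := by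
  induction n with
  | zero =>
    intro G _ _ f hf
    refine contDiffOn_zero.mpr fun α hα => ?_
    exact (hasFDerivAt_superpose hΩ (hf.of_le (by simp)) hα).continuousAt.continuousWithinAt
  | succ n ih =>
    intro G _ _ f hf
    have hd := fun α (hα : α ∈ {α : C(K, F) | ∀ τ, α τ ∈ Ω}) =>
      hasFDerivAt_superpose hΩ (hf.of_le (by simp)) hα
    rw [Nat.cast_add, Nat.cast_one, contDiffOn_succ_iff_fderiv_of_isOpen (isOpen_forall_mem hΩ)]
    refine ⟨fun α hα => (hd α hα).differentiableAt.differentiableWithinAt, by simp, ?_⟩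
    have hf' : ContDiffOn ℝ ∞ (fderiv ℝ f) Ω :=
      ((contDiffOn_infty_iff_fderiv_of_isOpen hΩ).mp hf).2
    have happly : ContDiff ℝ n (pointwiseApply K F G) := ContinuousLinearMap.contDiff _
    exact (happly.comp_contDiffOn (ih hf')).congr fun α hα => (hd α hα).fderiv

lemma contDiffOn_superpose.{u, v, w} {K : Type w} [TopologicalSpace K] [CompactSpace K]
    {F : Type u} [NormedAddCommGroup F] [NormedSpace ℝ F]
    {G : Type v} [NormedAddCommGroup G] [NormedSpace ℝ G] {f : F → G} {Ω : Set F}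
    (hΩ : IsOpen Ω) (hf : ContDiffOn ℝ ∞ f Ω) :
    ContDiffOn ℝ ∞ (superpose f : C(K, F) → C(K, G)) {α | ∀ τ, α τ ∈ Ω} := by
  let down : ULift.{u} G →L[ℝ] G := (ContinuousLinearEquiv.ulift : ULift.{u} G ≃L[ℝ] G)
  have hup : ContDiffOn ℝ ∞ (fun x => ULift.up.{u} (f x)) Ω :=
    (ContinuousLinearEquiv.ulift (R₁ := ℝ) (M₁ := G)).symm.contDiff.comp_contDiffOn hf
  refine ((down.compLeftContinuous ℝ K).contDiff.comp_contDiffOn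
    (contDiffOn_infty.mpr fun n => contDiffOn_nat_superpose.{u, max u v, w} hΩ n hup)).congr ?_
  intro α hα
  ext τ
  rw [superpose_apply hf.continuousOn hα]
  exact (congrArg down (superpose_apply hup.continuousOn hα τ)).symm

lemma superpose_comp {K L F G : Type*} [TopologicalSpace K] [TopologicalSpace L]
    [TopologicalSpace F] [TopologicalSpace G] [Zero G] {f : F → G} {Ω : Set F}
    (hf : ContinuousOn f Ω) {α : C(K, F)} (hα : ∀ τ, α τ ∈ Ω) (φ : C(L, K)) :
    superpose f (α.comp φ) = (superpose f α).comp φ := by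
  ext τ
  exact (superpose_apply hf (fun τ => hα (φ τ)) τ).trans (superpose_apply hf hα (φ τ)).symm

end Superposition

/-! ### Primitives of continuous maps on `[-1, 1]` -/

section Primitive

variable {F : Type*} [NormedAddCommGroup F]

/-- The symmetric unit interval `[-1, 1]`. -/
abbrev SymmInterval : Type := Set.Icc (-1 : ℝ) 1

/-- The extension of a continuous map on `[-1, 1]` to the real line, constant on both sides. -/
def extendMap (α : C(SymmInterval, F)) : ℝ → F := Set.IccExtend (by norm_num) α

lemma continuous_extendMap (α : C(SymmInterval, F)) : Continuous (extendMap α) :=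
  α.continuous.Icc_extend'

lemma extendMap_coe (α : C(SymmInterval, F)) (τ : SymmInterval) : extendMap α τ = α τ :=
  Set.IccExtend_val _ _ τ

lemma norm_extendMap_le (α : C(SymmInterval, F)) (τ : ℝ) : ‖extendMap α τ‖ ≤ ‖α‖ :=
  α.norm_coe_le_norm _

/-- The primitive `τ ↦ ∫_0^τ α` of a continuous map on `[-1, 1]`, as a continuous linear map. -/
def primitive (F : Type*) [NormedAddCommGroup F] [NormedSpace ℝ F] :
    C(SymmInterval, F) →L[ℝ] C(SymmInterval, F) :=
  LinearMap.mkContinuous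
    { toFun := fun α => ⟨fun τ => ∫ x in (0 : ℝ)..τ, extendMap α x,
        (intervalIntegral.continuous_primitive
          (fun a b => (continuous_extendMap α).intervalIntegrable a b) 0).comp
            continuous_subtype_val⟩
      map_add' := fun α β => by
        ext τ
        exact intervalIntegral.integral_add ((continuous_extendMap α).intervalIntegrable _ _)
          ((continuous_extendMap β).intervalIntegrable _ _)
      map_smul' := fun c α => by
        ext τ
        exact intervalIntegral.integral_smul c _ } 1
    (fun α => by
      refine (ContinuousMap.norm_le _ (by positivity)).mpr fun τ => ?_
      have hbound := intervalIntegral.norm_integral_le_of_norm_le_const (a := 0) (b := (τ : ℝ))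
        (f := extendMap α) (C := ‖α‖) (fun x _ => norm_extendMap_le α x)
      rw [sub_zero] at hbound
      rw [one_mul]
      exact hbound.trans (mul_le_of_le_one_right (norm_nonneg _) (abs_le.mpr τ.2)))

variable [NormedSpace ℝ F]

lemma primitive_eq_integral {α : C(SymmInterval, F)} {g : ℝ → F}
    (hg : ∀ x : SymmInterval, α x = g x) (τ : SymmInterval) :
    primitive F α τ = ∫ x in (0 : ℝ)..τ, g x := by
  refine intervalIntegral.integral_congr fun x hx => ?_
  have hx' : x ∈ Set.Icc (-1 : ℝ) 1 := Set.uIcc_subset_Icc (by norm_num) τ.2 hx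
  exact (extendMap_coe α ⟨x, hx'⟩).trans (hg ⟨x, hx'⟩)

lemma abs_mul_lt_of_mem_symmInterval {r s τ : ℝ} (hτ : τ ∈ Set.Icc (-1 : ℝ) 1) (hs : |s| < r) :
    |τ * s| < r := by
  rw [abs_mul]
  exact (mul_le_of_le_one_left (abs_nonneg s) (abs_le.mpr hτ)).trans_lt hs

/-- Multiplication by a number in `[-1, 1]`, as a map of `[-1, 1]` to itself. -/
def rescale (τ : SymmInterval) : C(SymmInterval, SymmInterval) :=
  ⟨fun x => ⟨τ * x, abs_le.mp (by
    rw [abs_mul]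
    exact mul_le_one₀ (abs_le.mpr τ.2) (abs_nonneg _) (abs_le.mpr x.2))⟩, by fun_prop⟩

lemma rescale_coe (τ x : SymmInterval) : (rescale τ x : ℝ) = τ * x := rfl

lemma smul_primitive_comp_rescale (α : C(SymmInterval, F)) (τ : SymmInterval) :
    (τ : ℝ) • primitive F (α.comp (rescale τ)) = (primitive F α).comp (rescale τ) := by
  ext x
  rw [ContinuousMap.smul_apply, ContinuousMap.comp_apply,
    primitive_eq_integral (g := fun z => extendMap α (τ * z))
      (fun z => (extendMap_coe α (rescale τ z)).symm),
    primitive_eq_integral (fun z => (extendMap_coe α z).symm), rescale_coe,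
    intervalIntegral.smul_integral_comp_mul_left, mul_zero]

end Primitive

/-! ### Hadamard's lemma -/

section Hadamard

variable {P : Type*} [NormedAddCommGroup P] [NormedSpace ℝ P]
  {E : Type*} [NormedAddCommGroup E] [NormedSpace ℝ E] [CompleteSpace E]

/-- The segment `τ ↦ (x, τ s)`, depending linearly on `(x, s)`. -/
def verticalSegment (P : Type*) [NormedAddCommGroup P] [NormedSpace ℝ P] :
    (P × ℝ) →L[ℝ] C(SymmInterval, P × ℝ) where
  toFun q := ⟨fun τ => (q.1, τ * q.2), by fun_prop⟩
  map_add' p q := by ext τ <;> simp [mul_add]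
  map_smul' c q := by ext τ <;> simp [mul_left_comm]
  cont := ContinuousMap.continuous_of_continuous_uncurry _
    (show Continuous fun z : (P × ℝ) × SymmInterval => (z.1.1, (z.2 : ℝ) * z.1.2) by fun_prop)

lemma exists_contDiffOn_eq_smul_of_eq_zero {A : Set P} (hA : IsOpen A) {r : ℝ} {G : P × ℝ → E}
    (hG : ContDiffOn ℝ ∞ G (A ×ˢ Set.Ioo (-r) r)) (h0 : ∀ x ∈ A, G (x, 0) = 0) :
    ∃ W : P × ℝ → E, ContDiffOn ℝ ∞ W (A ×ˢ Set.Ioo (-r) r) ∧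
      ∀ q ∈ A ×ˢ Set.Ioo (-r) r, G q = q.2 • W q := by
  set Ω : Set (P × ℝ) := A ×ˢ Set.Ioo (-r) r
  have hΩ : IsOpen Ω := hA.prod isOpen_Ioo
  set H : P × ℝ → E := fun q => fderiv ℝ G q (0, 1)
  have hH : ContDiffOn ℝ ∞ H Ω :=
    ((contDiffOn_infty_iff_fderiv_of_isOpen hΩ).mp hG).2.clm_apply contDiffOn_const
  have hseg : ∀ q ∈ Ω, ∀ τ, verticalSegment P q τ ∈ Ω := fun q hq τ =>
    ⟨hq.1, abs_lt.mp (abs_mul_lt_of_mem_symmInterval τ.2 (abs_lt.mpr hq.2))⟩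
  let one : SymmInterval := ⟨1, by norm_num⟩
  refine ⟨fun q => primitive E (superpose H (verticalSegment P q)) one, ?_, fun q hq => ?_⟩
  · exact ((ContinuousMap.evalCLM ℝ one).comp (primitive E)).contDiff.comp_contDiffOn
      ((contDiffOn_superpose hΩ hH).comp (verticalSegment P).contDiff.contDiffOn hseg)
  have hmem : ∀ x ∈ Set.uIcc (0 : ℝ) 1, (q.1, x * q.2) ∈ Ω := fun x hx => by
    rw [Set.uIcc_of_le zero_le_one] at hx
    exact hseg q hq ⟨x, by linarith [hx.1], hx.2⟩
  have hderiv : ∀ x ∈ Set.uIcc (0 : ℝ) 1,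
      HasDerivAt (fun x : ℝ => G (q.1, x * q.2)) (q.2 • H (q.1, x * q.2)) x := fun x hx => by
    have hline : HasDerivAt (fun x : ℝ => (q.1, x * q.2)) (q.2 • ((0 : P), (1 : ℝ))) x := by
      simpa using (hasDerivAt_const x q.1).prodMk ((hasDerivAt_id x).mul_const q.2)
    rw [← map_smul]
    exact (((hG.differentiableOn (by simp)).differentiableAt
      (hΩ.mem_nhds (hmem x hx))).hasFDerivAt).comp_hasDerivAt x hline
  have hint : IntervalIntegrable (fun x => q.2 • H (q.1, x * q.2)) MeasureTheory.volume 0 1 :=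
    ((hH.continuousOn.comp (by fun_prop) hmem).const_smul q.2).intervalIntegrable
  change G q = q.2 • primitive E (superpose H (verticalSegment P q)) one
  rw [primitive_eq_integral (g := fun x => H (q.1, x * q.2))
    (fun x => superpose_apply hH.continuousOn (hseg q hq) x), ← intervalIntegral.integral_smul,
    intervalIntegral.integral_eq_sub_of_hasDerivAt hderiv hint]
  simp [h0 q.1 hq.1]

lemma exists_contDiffOn_eq_sub_smul_of_eq_zero {t₀ r : ℝ} {g : ℝ → E}
    (hg : ContDiffOn ℝ ∞ g (Metric.ball t₀ r)) (h0 : g t₀ = 0) :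
    ∃ v : ℝ → E, ContDiffOn ℝ ∞ v (Metric.ball t₀ r) ∧
      ∀ t ∈ Metric.ball t₀ r, g t = (t - t₀) • v t := by
  obtain ⟨W, hW, hGW⟩ := exists_contDiffOn_eq_smul_of_eq_zero (P := ℝ) (A := Set.univ) (r := r)
    isOpen_univ (G := fun q => g (t₀ + q.2))
    (hg.comp (by fun_prop) fun q hq => by
      simpa [Real.dist_eq] using abs_lt.mpr hq.2)
    (fun t _ => by simpa using h0)
  have hmem : ∀ t ∈ Metric.ball t₀ r, ((0 : ℝ), t - t₀) ∈ (Set.univ : Set ℝ) ×ˢ Set.Ioo (-r) r :=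
    fun t ht => ⟨trivial, abs_lt.mp ht⟩
  exact ⟨fun t => W (0, t - t₀), hW.comp (by fun_prop) hmem,
    fun t ht => by simpa using hGW _ (hmem t ht)⟩

end Hadamard

/-! ### Smooth dependence of solutions of ODEs on the initial condition -/

section Flow

lemma tendsto_graph {X Y : Type*} [TopologicalSpace X] [TopologicalSpace Y] {f : X → Y} {x : X}
    {y : Y} (hf : ContinuousAt f x) (hfx : f x = y) :
    Filter.Tendsto (fun z => (z, f z)) (𝓝 x) (𝓝 (x, y)) :=
  hfx ▸ continuousAt_id.prodMk hf

lemma exists_implicitFunction_contDiffAt {E₁ E₂ F : Type*}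
    [NormedAddCommGroup E₁] [NormedSpace ℝ E₁] [CompleteSpace E₁]
    [NormedAddCommGroup E₂] [NormedSpace ℝ E₂] [CompleteSpace E₂]
    [NormedAddCommGroup F] [NormedSpace ℝ F] [CompleteSpace F]
    {f : E₁ × E₂ → F} {D : Set (E₁ × E₂)} (hD : IsOpen D) (hf : ContDiffOn ℝ ∞ f D)
    {p : E₁ × E₂} (hp : p ∈ D) (hinv : (fderiv ℝ f p ∘L .inr ℝ E₁ E₂).IsInvertible) :
    ∃ ψ : E₁ → E₂, ψ p.1 = p.2 ∧ (∀ᶠ x in 𝓝 p.1, ContDiffAt ℝ ∞ ψ x) ∧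
      ∀ᶠ v in 𝓝 p, f v = f p ↔ ψ v.1 = v.2 := by
  have hat : ∀ v ∈ D, ContDiffAt ℝ ∞ f v := fun v hv => hf.contDiffAt (hD.mem_nhds hv)
  let ψ := (hat p hp).implicitFunction (by simp) hinv
  have hψp : ψ p.1 = p.2 := (hat p hp).implicitFunction_apply_self _ _
  have hiff : ∀ᶠ v in 𝓝 p, f v = f p ↔ ψ v.1 = v.2 :=
    (hat p hp).eventually_apply_eq_iff_implicitFunction _ _
  refine ⟨ψ, hψp, ?_, hiff⟩
  have hfd : ContinuousAt (fun v => fderiv ℝ f v ∘L .inr ℝ E₁ E₂) p :=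
    ((hf.continuousOn_fderiv_of_isOpen hD (by simp)).continuousAt (hD.mem_nhds hp)).clm_comp
      continuousAt_const
  have hgood : ∀ᶠ v in 𝓝 p, v ∈ D ∧ (fderiv ℝ f v ∘L .inr ℝ E₁ E₂).IsInvertible ∧
      ∀ᶠ w in 𝓝 v, f w = f p ↔ ψ w.1 = w.2 :=
    (hD.eventually_mem hp).and
      ((hfd.eventually_mem (ContinuousLinearEquiv.isOpen.mem_nhds hinv)).and hiff.eventually_nhds)
  have hψ : ContinuousAt ψ p.1 :=
    ((hat p hp).contDiffAt_implicitFunction (by simp) hinv).continuousAt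
  filter_upwards [(tendsto_graph hψ hψp).eventually hgood] with x ⟨hxD, hxinv, hxiff⟩
  -- The implicit function at `(x, ψ x)` is smooth at `x` and agrees with `ψ` near `x`.
  let χ := (hat _ hxD).implicitFunction (by simp) hxinv
  have hχ : ContDiffAt ℝ ∞ χ x := (hat _ hxD).contDiffAt_implicitFunction _ hxinv
  have hχx : χ x = ψ x := (hat _ hxD).implicitFunction_apply_self _ _
  refine hχ.congr_of_eventuallyEq ?_
  filter_upwards [(tendsto_graph hχ.continuousAt hχx).eventually hxiff,
    (hat _ hxD).eventually_apply_implicitFunction (by simp) hxinv] with y hyiff hy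
  exact hyiff.mp (hy.trans (hxiff.self_of_nhds.mpr rfl))

variable {F : Type*} [NormedAddCommGroup F] [NormedSpace ℝ F]

/-- Constant maps, as a continuous linear map. -/
def constMap (K F : Type*) [TopologicalSpace K] [NormedAddCommGroup F] [NormedSpace ℝ F] :
    F →L[ℝ] C(K, F) where
  toFun y := ContinuousMap.const K y
  map_add' _ _ := rfl
  map_smul' _ _ := rfl
  cont := ContinuousMap.continuous_const'

/-- The map `((y, s), α) ↦ α - y - s ∫ X(α)`, whose zeros are the solutions of `α' = s X(α)` on
`[-1, 1]` with the initial value `y`. -/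
def picardDefect (X : F → F) (p : (F × ℝ) × C(SymmInterval, F)) : C(SymmInterval, F) :=
  p.2 - constMap SymmInterval F p.1.1 - p.1.2 • primitive F (superpose X p.2)

lemma contDiffOn_picardDefect {X : F → F} {Ω : Set F} (hΩ : IsOpen Ω)
    (hX : ContDiffOn ℝ ∞ X Ω) :
    ContDiffOn ℝ ∞ (picardDefect X) (Set.univ ×ˢ {α | ∀ τ, α τ ∈ Ω}) := by
  have hsuperpose : ContDiffOn ℝ ∞ (fun p : (F × ℝ) × C(SymmInterval, F) => superpose X p.2)
      (Set.univ ×ˢ {α | ∀ τ, α τ ∈ Ω}) :=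
    (contDiffOn_superpose hΩ hX).comp contDiff_snd.contDiffOn fun p hp => hp.2
  have hprimitive := (primitive F).contDiff (n := ∞) |>.comp_contDiffOn hsuperpose
  have hconst : ContDiff ℝ ∞ fun p : (F × ℝ) × C(SymmInterval, F) =>
      p.2 - constMap SymmInterval F p.1.1 :=
    contDiff_snd.sub ((constMap SymmInterval F).contDiff.comp (contDiff_fst.comp contDiff_fst))
  exact hconst.contDiffOn.sub ((contDiff_snd.comp contDiff_fst).contDiffOn.smul hprimitive)

lemma picardDefect_rescale {X : F → F} {Ω : Set F} (hX : ContinuousOn X Ω) {y : F} {s : ℝ}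
    {α : C(SymmInterval, F)} (hα : ∀ τ, α τ ∈ Ω) (τ : SymmInterval) :
    picardDefect X ((y, τ * s), α.comp (rescale τ))
      = (picardDefect X ((y, s), α)).comp (rescale τ) := by
  rw [picardDefect, superpose_comp hX hα, mul_comm, mul_smul, smul_primitive_comp_rescale]
  rfl

lemma dist_comp_rescale_lt {α : C(SymmInterval, F)} {y₀ : F} {ρ : ℝ} (hρ : 0 < ρ)
    (h : dist α (constMap SymmInterval F y₀) < ρ) (τ : SymmInterval) :
    dist (α.comp (rescale τ)) (constMap SymmInterval F y₀) < ρ := by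
  rw [ContinuousMap.dist_lt_iff hρ] at h ⊢
  exact fun x => h (rescale τ x)

lemma fderiv_picardDefect_comp_inr {X : F → F} {Ω : Set F} (hΩ : IsOpen Ω)
    (hX : ContDiffOn ℝ ∞ X Ω) {y₀ : F} (hy₀ : y₀ ∈ Ω) :
    fderiv ℝ (picardDefect X) ((y₀, 0), constMap SymmInterval F y₀) ∘L
      .inr ℝ (F × ℝ) C(SymmInterval, F) = .id ℝ C(SymmInterval, F) := by
  set α₀ := constMap SymmInterval F y₀
  have hdiff : DifferentiableAt ℝ (picardDefect X) ((y₀, 0), α₀) :=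
    ((contDiffOn_picardDefect hΩ hX).contDiffAt
      ((isOpen_univ.prod (isOpen_forall_mem hΩ)).mem_nhds ⟨trivial, fun _ => hy₀⟩)).differentiableAt
      (by simp)
  have hpartial : HasFDerivAt (fun α => picardDefect X ((y₀, 0), α))
      (.id ℝ C(SymmInterval, F)) α₀ := by
    simpa [picardDefect] using (hasFDerivAt_id (𝕜 := ℝ) α₀).sub_const α₀
  exact (hdiff.hasFDerivAt.comp α₀ (hasFDerivAt_prodMk_right (𝕜 := ℝ) (y₀, (0 : ℝ)) α₀)).unique
    hpartial

variable [CompleteSpace F]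

lemma exists_contDiffOn_picardDefect_eq_zero {X : F → F} {Ω : Set F} (hΩ : IsOpen Ω)
    (hX : ContDiffOn ℝ ∞ X Ω) {y₀ : F} (hy₀ : y₀ ∈ Ω) :
    ∃ r > 0, ∃ Z : F × ℝ → C(SymmInterval, F),
      ContDiffOn ℝ ∞ Z (Metric.ball (y₀, (0 : ℝ)) r) ∧
      ∀ y s, (y, s) ∈ Metric.ball (y₀, (0 : ℝ)) r →
        (∀ τ, Z (y, s) τ ∈ Ω) ∧ picardDefect X ((y, s), Z (y, s)) = 0 ∧
        ∀ τ : SymmInterval, Z (y, τ * s) = (Z (y, s)).comp (rescale τ) := by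
  set p₀ : (F × ℝ) × C(SymmInterval, F) := ((y₀, 0), constMap SymmInterval F y₀)
  have hD : IsOpen (Set.univ ×ˢ {α | ∀ τ, α τ ∈ Ω} : Set ((F × ℝ) × C(SymmInterval, F))) :=
    isOpen_univ.prod (isOpen_forall_mem hΩ)
  have hp₀ : p₀ ∈ (Set.univ ×ˢ {α | ∀ τ, α τ ∈ Ω} : Set ((F × ℝ) × C(SymmInterval, F))) :=
    ⟨trivial, fun _ => hy₀⟩
  have hdefect₀ : picardDefect X p₀ = 0 := by simp [picardDefect, p₀]
  obtain ⟨Z, hZ₀, hZ, hiff⟩ := exists_implicitFunction_contDiffAt hD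
    (contDiffOn_picardDefect hΩ hX) hp₀
    (by rw [fderiv_picardDefect_comp_inr hΩ hX hy₀]; exact ⟨.refl ℝ _, rfl⟩)
  obtain ⟨ρ, hρ, hball⟩ := Metric.eventually_nhds_iff_ball.mp ((hD.eventually_mem hp₀).and hiff)
  have hgraph : Filter.Tendsto (fun p => (p, Z p)) (𝓝 (y₀, 0)) (𝓝 p₀) :=
    tendsto_graph hZ.self_of_nhds.continuousAt hZ₀
  obtain ⟨r, hr, hgood⟩ := Metric.eventually_nhds_iff_ball.mp
    (hZ.and (hgraph.eventually_mem (Metric.ball_mem_nhds p₀ hρ)))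
  refine ⟨r, hr, Z, fun p hp => (hgood p hp).1.contDiffWithinAt, fun y s hys => ?_⟩
  obtain ⟨⟨-, hmem⟩, hdefect⟩ := hball _ (hgood _ hys).2
  have hzero : picardDefect X ((y, s), Z (y, s)) = 0 := (hdefect.mpr rfl).trans hdefect₀
  refine ⟨hmem, hzero, fun τ => ?_⟩
  -- Rescaling `Z (y, s)` keeps it close to `p₀`, where the zeros of the defect are unique.
  have hnear : ((y, τ * s), (Z (y, s)).comp (rescale τ)) ∈ Metric.ball p₀ ρ := by
    have h := (hgood _ hys).2
    simp only [p₀, Metric.mem_ball, Prod.dist_eq, max_lt_iff, Real.dist_eq, sub_zero] at h ⊢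
    exact ⟨⟨h.1.1, abs_mul_lt_of_mem_symmInterval τ.2 h.1.2⟩, dist_comp_rescale_lt hρ h.2 τ⟩
  refine (hball _ hnear).2.mp ?_
  rw [picardDefect_rescale hX.continuousOn hmem, hzero, hdefect₀]
  rfl

lemma exists_contDiffOn_flow_integral {X : F → F} {Ω : Set F} (hΩ : IsOpen Ω)
    (hX : ContDiffOn ℝ ∞ X Ω) {y₀ : F} (hy₀ : y₀ ∈ Ω) :
    ∃ r > 0, ∃ Φ : F × ℝ → F, ContDiffOn ℝ ∞ Φ (Metric.ball y₀ r ×ˢ Set.Ioo (-r) r) ∧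
      ∀ y ∈ Metric.ball y₀ r, ∀ s ∈ Set.Ioo (-r) r,
        Φ (y, s) ∈ Ω ∧ Φ (y, s) = y + ∫ x in (0 : ℝ)..s, X (Φ (y, x)) := by
  obtain ⟨r, hr, Z, hZ, hsol⟩ := exists_contDiffOn_picardDefect_eq_zero hΩ hX hy₀
  have hball : Metric.ball (y₀, (0 : ℝ)) r = Metric.ball y₀ r ×ˢ Set.Ioo (-r) r := by
    rw [← ball_prod_same, Real.ball_zero_eq_Ioo]
  let one : SymmInterval := ⟨1, by norm_num⟩
  refine ⟨r, hr, fun p => Z p one,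
    hball ▸ (ContinuousMap.evalCLM ℝ one : C(_, F) →L[ℝ] F).contDiff.comp_contDiffOn hZ,
    fun y hy s hs => ?_⟩
  obtain ⟨hmem, hzero, hscale⟩ := hsol y s (hball ▸ ⟨hy, hs⟩)
  refine ⟨hmem one, ?_⟩
  have hvalue : ∀ τ : SymmInterval, superpose X (Z (y, s)) τ = X (Z (y, τ * s) one) := fun τ => by
    rw [superpose_apply hX.continuousOn hmem, hscale, ContinuousMap.comp_apply]
    congr 2
    exact Subtype.ext (mul_one (τ : ℝ)).symm
  have hone : Z (y, s) one - y - s • primitive F (superpose X (Z (y, s))) one = 0 :=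
    congrArg (fun β : C(SymmInterval, F) => β one) hzero
  rw [primitive_eq_integral (g := fun x => X (Z (y, x * s) one)) hvalue,
    intervalIntegral.smul_integral_comp_mul_right (fun x => X (Z (y, x) one)), zero_mul,
    one_mul, sub_sub, sub_eq_zero] at hone
  exact hone

lemma exists_contDiffOn_flow {X : F → F} {Ω : Set F} (hΩ : IsOpen Ω) (hX : ContDiffOn ℝ ∞ X Ω)
    {y₀ : F} (hy₀ : y₀ ∈ Ω) :
    ∃ r > 0, ∃ Φ : F × ℝ → F, ContDiffOn ℝ ∞ Φ (Metric.ball y₀ r ×ˢ Set.Ioo (-r) r) ∧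
      (∀ y ∈ Metric.ball y₀ r, Φ (y, 0) = y) ∧
      ∀ y ∈ Metric.ball y₀ r, ∀ s ∈ Set.Ioo (-r) r,
        Φ (y, s) ∈ Ω ∧ HasDerivAt (fun s => Φ (y, s)) (X (Φ (y, s))) s := by
  obtain ⟨r, hr, Φ, hΦ, hint⟩ := exists_contDiffOn_flow_integral hΩ hX hy₀
  have h0 : (0 : ℝ) ∈ Set.Ioo (-r) r := by simpa using hr
  refine ⟨r, hr, Φ, hΦ, fun y hy => by simpa using (hint y hy 0 h0).2, fun y hy s hs => ?_⟩
  have hcont : ContinuousOn (fun x => X (Φ (y, x))) (Set.Ioo (-r) r) :=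
    hX.continuousOn.comp (hΦ.continuousOn.comp (by fun_prop) fun x hx => ⟨hy, hx⟩)
      fun x hx => (hint y hy x hx).1
  have hintegral := intervalIntegral.integral_hasDerivAt_right
    ((hcont.mono (Set.OrdConnected.uIcc_subset Set.ordConnected_Ioo h0 hs)).intervalIntegrable)
    (hcont.stronglyMeasurableAtFilter isOpen_Ioo s hs)
    (hcont.continuousAt (isOpen_Ioo.mem_nhds hs))
  refine ⟨(hint y hy s hs).1, (hintegral.const_add y).congr_of_eventuallyEq ?_⟩
  filter_upwards [isOpen_Ioo.mem_nhds hs] with x hx using (hint y hy x hx).2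

end Flow

/-! ### Covariant differentiation along a line -/

section LinearConnection

variable {E : Type*} [NormedAddCommGroup E] [NormedSpace ℝ E]
  {A : Set ℝ} {B : ℝ → E →L[ℝ] E} {u v w : ℝ → E} {t t₀ : ℝ}

/-- The covariant derivative `w ↦ w' + B w` on the functions of one variable with values in `E`. -/
def connDeriv (B : ℝ → E →L[ℝ] E) (w : ℝ → E) (t : ℝ) : E := deriv w t + B t (w t)

/-- The connection form of the connection `d + Γ` contracted with the velocity of `g`, so that
`connDeriv (connAlong Γ g)` is the covariant derivative of vector fields along `g`. The last
argument of `Γ x` is the direction of differentiation. -/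
def connAlong (Γ : E → E →L[ℝ] E →L[ℝ] E) (g : ℝ → E) (t : ℝ) : E →L[ℝ] E :=
  (Γ (g t)).flip (deriv g t)

lemma contDiffOn_connAlong {Γ : E → E →L[ℝ] E →L[ℝ] E} {Θ : Set E} (hΓ : ContDiffOn ℝ ∞ Γ Θ)
    {g : ℝ → E} (hA : IsOpen A) (hg : ContDiffOn ℝ ∞ g A) (hgΘ : ∀ t ∈ A, g t ∈ Θ) :
    ContDiffOn ℝ ∞ (connAlong Γ g) A :=
  ((ContinuousLinearMap.flipₗᵢ ℝ E E E).contDiff.comp_contDiffOn (hΓ.comp hg hgΘ)).clm_apply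
    ((contDiffOn_infty_iff_deriv_of_isOpen hA).mp hg).2

lemma differentiableAt_of_contDiffOn (hA : IsOpen A) (hw : ContDiffOn ℝ ∞ w A) (ht : t ∈ A) :
    DifferentiableAt ℝ w t :=
  (hw.differentiableOn (by simp)).differentiableAt (hA.mem_nhds ht)

lemma contDiffOn_connDeriv (hA : IsOpen A) (hB : ContDiffOn ℝ ∞ B A) (hw : ContDiffOn ℝ ∞ w A) :
    ContDiffOn ℝ ∞ (connDeriv B w) A :=
  ((contDiffOn_infty_iff_deriv_of_isOpen hA).mp hw).2.add (hB.clm_apply hw)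

lemma contDiffOn_iterate_connDeriv (hA : IsOpen A) (hB : ContDiffOn ℝ ∞ B A)
    (hw : ContDiffOn ℝ ∞ w A) (n : ℕ) : ContDiffOn ℝ ∞ ((connDeriv B)^[n] w) A := by
  induction n with
  | zero => exact hw
  | succ n ih =>
    rw [Function.iterate_succ_apply']
    exact contDiffOn_connDeriv hA hB ih

lemma eqOn_connDeriv (hA : IsOpen A) (h : Set.EqOn v w A) :
    Set.EqOn (connDeriv B v) (connDeriv B w) A := fun t ht => by
  rw [connDeriv, (h.eventuallyEq_of_mem (hA.mem_nhds ht)).deriv_eq, h ht, connDeriv]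

lemma eqOn_iterate_connDeriv (hA : IsOpen A) (h : Set.EqOn v w A) (n : ℕ) :
    Set.EqOn ((connDeriv B)^[n] v) ((connDeriv B)^[n] w) A := by
  induction n with
  | zero => exact h
  | succ n ih =>
    simp only [Function.iterate_succ_apply']
    exact eqOn_connDeriv hA ih

lemma connDeriv_add (hv : DifferentiableAt ℝ v t) (hw : DifferentiableAt ℝ w t) :
    connDeriv B (fun s => v s + w s) t = connDeriv B v t + connDeriv B w t := by
  rw [connDeriv, deriv_fun_add hv hw, map_add, connDeriv, connDeriv, add_add_add_comm]

lemma connDeriv_smul {f : ℝ → ℝ} (hf : DifferentiableAt ℝ f t) (hw : DifferentiableAt ℝ w t) :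
    connDeriv B (fun s => f s • w s) t = deriv f t • w t + f t • connDeriv B w t := by
  rw [connDeriv, deriv_fun_smul hf hw, map_smul, connDeriv, smul_add]
  abel

lemma iterate_connDeriv_sub_smul (hA : IsOpen A) (hB : ContDiffOn ℝ ∞ B A)
    (hw : ContDiffOn ℝ ∞ w A) (n : ℕ) :
    Set.EqOn ((connDeriv B)^[n + 1] fun t => (t - t₀) • w t)
      (fun t => (t - t₀) • (connDeriv B)^[n + 1] w t + (n + 1 : ℝ) • (connDeriv B)^[n] w t) A := by
  have hd (k : ℕ) {t : ℝ} (ht : t ∈ A) : DifferentiableAt ℝ ((connDeriv B)^[k] w) t :=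
    differentiableAt_of_contDiffOn hA (contDiffOn_iterate_connDeriv hA hB hw k) ht
  induction n with
  | zero =>
    intro t ht
    have h := connDeriv_smul (B := B) (differentiableAt_id.sub_const t₀) (hd 0 ht)
    simpa [add_comm] using h
  | succ n ih =>
    intro t ht
    have hsub : DifferentiableAt ℝ (fun s => s - t₀) t := differentiableAt_id.sub_const t₀
    rw [Function.iterate_succ_apply', eqOn_connDeriv hA ih ht,
      connDeriv_add (hsub.fun_smul (hd (n + 1) ht)) ((hd n ht).fun_const_smul _),
      connDeriv_smul hsub (hd (n + 1) ht),
      connDeriv_smul (differentiableAt_const _) (hd n ht),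
      ← Function.iterate_succ_apply' (connDeriv B) n,
      ← Function.iterate_succ_apply' (connDeriv B) (n + 1)]
    simp only [deriv_sub_const, deriv_id'', deriv_const, Nat.cast_add, Nat.cast_one]
    module

lemma iterate_connDeriv_pow_smul_apply (hA : IsOpen A) (ht₀ : t₀ ∈ A) (hB : ContDiffOn ℝ ∞ B A)
    (hv : ContDiffOn ℝ ∞ v A) (m j : ℕ) :
    (connDeriv B)^[m + j] (fun t => (t - t₀) ^ m • v t) t₀
      = ((m + j).descFactorial m : ℝ) • (connDeriv B)^[j] v t₀ := by
  induction m with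
  | zero => simp
  | succ m ih =>
    have hw : ContDiffOn ℝ ∞ (fun t => (t - t₀) ^ m • v t) A := by fun_prop
    simp only [pow_succ', mul_smul]
    rw [Nat.add_right_comm, iterate_connDeriv_sub_smul hA hB hw (m + j) ht₀,
      Nat.succ_descFactorial_succ]
    simp [ih, smul_smul]

lemma exists_eq_pow_smul_of_iterate_connDeriv_eq_zero [CompleteSpace E] {r : ℝ} (hr : 0 < r)
    (hB : ContDiffOn ℝ ∞ B (Metric.ball t₀ r)) (hw : ContDiffOn ℝ ∞ w (Metric.ball t₀ r)) (m : ℕ)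
    (hzero : ∀ i < m, (connDeriv B)^[i] w t₀ = 0) :
    ∃ v : ℝ → E, ContDiffOn ℝ ∞ v (Metric.ball t₀ r) ∧
      ∀ t ∈ Metric.ball t₀ r, w t = (t - t₀) ^ m • v t := by
  induction m with
  | zero => exact ⟨w, hw, fun t _ => by simp⟩
  | succ m ih =>
    obtain ⟨v, hv, hwv⟩ := ih fun i hi => hzero i (by omega)
    have ht₀ := Metric.mem_ball_self (x := t₀) hr
    have hv₀ : v t₀ = 0 := by
      have h := hzero m m.lt_succ_self
      rw [eqOn_iterate_connDeriv Metric.isOpen_ball hwv m ht₀] at h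
      have hpow := iterate_connDeriv_pow_smul_apply Metric.isOpen_ball ht₀ hB hv m 0
      rw [add_zero, h, Nat.descFactorial_self, eq_comm] at hpow
      exact (smul_eq_zero_iff_right (Nat.cast_ne_zero.mpr m.factorial_ne_zero)).mp hpow
    obtain ⟨v', hv', hvv'⟩ := exists_contDiffOn_eq_sub_smul_of_eq_zero hv hv₀
    exact ⟨v', hv', fun t ht => by rw [hwv t ht, hvv' t ht, smul_smul, pow_succ]⟩

lemma exists_contDiffOn_eq_smul (hA : IsOpen A) (ht₀ : t₀ ∈ A) (hu : ContDiffOn ℝ ∞ u A)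
    (hv : ContDiffOn ℝ ∞ v A) (hu₀ : u t₀ ≠ 0)
    (hprop : ∀ t ∈ A, t ≠ t₀ → ∃ a : ℝ, v t = a • u t) :
    ∃ A' ⊆ A, IsOpen A' ∧ t₀ ∈ A' ∧ ∃ b : ℝ → ℝ, ContDiffOn ℝ ∞ b A' ∧
      ∀ t ∈ A', v t = b t • u t := by
  obtain ⟨ℓ, hℓ⟩ := SeparatingDual.exists_ne_zero (R := ℝ) hu₀
  have hℓu : ContDiffOn ℝ ∞ (fun t => ℓ (u t)) A := ℓ.contDiff.comp_contDiffOn hu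
  have hℓv : ContDiffOn ℝ ∞ (fun t => ℓ (v t)) A := ℓ.contDiff.comp_contDiffOn hv
  set A' : Set ℝ := A ∩ (fun t => ℓ (u t)) ⁻¹' {0}ᶜ
  have hA' : IsOpen A' := hℓu.continuousOn.isOpen_inter_preimage hA isOpen_compl_singleton
  have hA'A : A' ⊆ A := Set.inter_subset_left
  set b : ℝ → ℝ := fun t => ℓ (v t) / ℓ (u t)
  have hb : ContDiffOn ℝ ∞ b A' := (hℓv.mono hA'A).div (hℓu.mono hA'A) fun t ht => ht.2
  have hne : ∀ t ∈ A', t ≠ t₀ → v t = b t • u t := by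
    intro t ht htt
    obtain ⟨a, ha⟩ := hprop t ht.1 htt
    have hba : b t = a := by
      simp only [b, ha, map_smul, smul_eq_mul]
      exact mul_div_cancel_right₀ _ ht.2
    rw [hba, ha]
  -- Both sides are continuous, and `t₀` is not isolated.
  have hlim : v t₀ = b t₀ • u t₀ := by
    have hcont {f : ℝ → E} (hf : ContDiffOn ℝ ∞ f A') : Filter.Tendsto f (𝓝[≠] t₀) (𝓝 (f t₀)) :=
      (hf.continuousOn.continuousAt (hA'.mem_nhds ⟨ht₀, hℓ⟩)).tendsto.mono_left nhdsWithin_le_nhds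
    refine tendsto_nhds_unique (hcont (hv.mono hA'A))
      ((hcont (hb.smul (hu.mono hA'A))).congr' ?_)
    filter_upwards [self_mem_nhdsWithin, nhdsWithin_le_nhds (hA'.mem_nhds ⟨ht₀, hℓ⟩)] with s hs hs'
    exact (hne s hs' hs).symm
  refine ⟨A', hA'A, hA', ⟨ht₀, hℓ⟩, b, hb, fun t ht => ?_⟩
  rcases eq_or_ne t t₀ with rfl | htt
  exacts [hlim, hne t ht htt]

lemma linearIndependent_of_smul_of_smul_add {x y : E} {a b c : ℝ}
    (h : LinearIndependent ℝ ![b • x, a • x + c • y]) : LinearIndependent ℝ ![x, y] := by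
  have hb : b ≠ 0 := fun hb => h.ne_zero 0 (by simp [hb])
  have hx : x ≠ 0 := fun hx => h.ne_zero 0 (by simp [hx])
  rw [LinearIndependent.pair_iff' (smul_ne_zero hb hx)] at h
  refine (LinearIndependent.pair_iff' hx).mpr fun d hd => h ((a + c * d) / b) ?_
  rw [smul_smul, div_mul_cancel₀ _ hb, ← hd]
  module

lemma exists_contDiffOn_factor_of_pow_smul (hA : IsOpen A) (ht₀ : t₀ ∈ A)
    (hu : ContDiffOn ℝ ∞ u A) (hv : ContDiffOn ℝ ∞ v A) {m : ℕ}
    (hw : ∀ t ∈ A, w t = (t - t₀) ^ m • v t) (hu₀ : u t₀ ≠ 0)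
    (hprop : ∀ t ∈ A, ∃ a : ℝ, w t = a • u t)
    (hind : LinearIndependent ℝ ![v t₀, connDeriv B v t₀]) :
    ∃ A' ⊆ A, IsOpen A' ∧ t₀ ∈ A' ∧ ∃ a : ℝ → ℝ, ContDiffOn ℝ ∞ a A' ∧
      (∀ t ∈ A', w t = a t • u t) ∧ LinearIndependent ℝ ![u t₀, connDeriv B u t₀] := by
  obtain ⟨A', hA'A, hA', ht₀', b, hb, hvb⟩ := exists_contDiffOn_eq_smul hA ht₀ hu hv hu₀
    fun t ht htt => by
      obtain ⟨a, ha⟩ := hprop t ht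
      rw [hw t ht] at ha
      exact ⟨a / (t - t₀) ^ m, by
        rw [div_eq_inv_mul, mul_smul, ← ha, inv_smul_smul₀ (pow_ne_zero m (sub_ne_zero.mpr htt))]⟩
  refine ⟨A', hA'A, hA', ht₀', fun t => (t - t₀) ^ m * b t, by fun_prop, fun t ht => ?_, ?_⟩
  · rw [hw t (hA'A ht), hvb t ht, mul_smul]
  · rw [hvb t₀ ht₀', eqOn_connDeriv hA' hvb ht₀',
      connDeriv_smul ((hb.differentiableOn (by simp)).differentiableAt (hA'.mem_nhds ht₀'))
        (differentiableAt_of_contDiffOn hA hu ht₀)] at hind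
    exact linearIndependent_of_smul_of_smul_add hind

end LinearConnection

/-! ### Families of geodesics in coordinates -/

section CoordinateSurface

variable {E : Type*} [NormedAddCommGroup E] [NormedSpace ℝ E]

section PartialDerivatives

variable {Q : Set (ℝ × ℝ)} {H : ℝ × ℝ → E} {q : ℝ × ℝ}

lemma hasDerivAt_vertical (hQ : IsOpen Q) (hH : ContDiffOn ℝ ∞ H Q) (hq : q ∈ Q) :
    HasDerivAt (fun s => H (q.1, s)) (fderiv ℝ H q (0, 1)) q.2 :=
  HasFDerivAt.comp_hasDerivAt (f := fun s : ℝ => (q.1, s)) q.2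
    ((hH.differentiableOn (by simp)).differentiableAt (hQ.mem_nhds hq)).hasFDerivAt
    ((hasDerivAt_const q.2 q.1).prodMk (hasDerivAt_id q.2))

lemma hasDerivAt_horizontal (hQ : IsOpen Q) (hH : ContDiffOn ℝ ∞ H Q) (hq : q ∈ Q) :
    HasDerivAt (fun t => H (t, q.2)) (fderiv ℝ H q (1, 0)) q.1 :=
  HasFDerivAt.comp_hasDerivAt (f := fun t : ℝ => (t, q.2)) q.1
    ((hH.differentiableOn (by simp)).differentiableAt (hQ.mem_nhds hq)).hasFDerivAt
    ((hasDerivAt_id q.1).prodMk (hasDerivAt_const q.1 q.2))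

lemma contDiffOn_fderiv_apply_const (hQ : IsOpen Q) (hH : ContDiffOn ℝ ∞ H Q) (x : ℝ × ℝ) :
    ContDiffOn ℝ ∞ (fun q => fderiv ℝ H q x) Q :=
  ((contDiffOn_infty_iff_fderiv_of_isOpen hQ).mp hH).2.clm_apply contDiffOn_const

lemma fderiv_fderiv_apply_comm (hQ : IsOpen Q) (hH : ContDiffOn ℝ ∞ H Q) (hq : q ∈ Q)
    (x y : ℝ × ℝ) :
    fderiv ℝ (fun p => fderiv ℝ H p x) q y = fderiv ℝ (fun p => fderiv ℝ H p y) q x := by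
  have hd : DifferentiableAt ℝ (fderiv ℝ H) q :=
    (((contDiffOn_infty_iff_fderiv_of_isOpen hQ).mp hH).2.differentiableOn
      (by simp)).differentiableAt (hQ.mem_nhds hq)
  have hsymm : IsSymmSndFDerivAt ℝ H q :=
    (hH.contDiffAt (hQ.mem_nhds hq)).isSymmSndFDerivAt
      (by simp only [minSmoothness_of_isRCLikeNormedField]; norm_cast)
  rw [fderiv_clm_apply hd (by fun_prop), fderiv_clm_apply hd (by fun_prop)]
  simpa using hsymm y x

end PartialDerivatives

/-- The geodesic spray `(x, v) ↦ (v, -Γ(x)(v, v))` in coordinates. -/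
def spray (Γ : E → E →L[ℝ] E →L[ℝ] E) (y : E × E) : E × E := (y.2, -Γ y.1 y.2 y.2)

lemma contDiffOn_spray {Γ : E → E →L[ℝ] E →L[ℝ] E} {Θ : Set E} (hΓ : ContDiffOn ℝ ∞ Γ Θ) :
    ContDiffOn ℝ ∞ (spray Γ) (Θ ×ˢ Set.univ) := by
  have h : ContDiffOn ℝ ∞ (fun y : E × E => Γ y.1) (Θ ×ˢ Set.univ) :=
    hΓ.comp contDiff_fst.contDiffOn fun y hy => hy.1
  exact contDiff_snd.contDiffOn.prodMk
    ((h.clm_apply contDiff_snd.contDiffOn).clm_apply contDiff_snd.contDiffOn).neg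

/-- In coordinates, `s ↦ S (t, s)`, for `|s| < r`, is the geodesic of the connection `d + Γ` on `Θ`
issuing from `g t` with the velocity `u t`, for `t ∈ A`; its velocity at the time `s` is
`V (t, s)`. -/
structure IsCoordGeodesicFamilyOn (Γ : E → E →L[ℝ] E →L[ℝ] E) (Θ : Set E) (g u : ℝ → E)
    (A : Set ℝ) (r : ℝ) (S V : ℝ × ℝ → E) : Prop where
  contDiffOn_position : ContDiffOn ℝ ∞ S (A ×ˢ Set.Ioo (-r) r)
  contDiffOn_velocity : ContDiffOn ℝ ∞ V (A ×ˢ Set.Ioo (-r) r)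
  position_zero : ∀ t ∈ A, S (t, 0) = g t
  velocity_zero : ∀ t ∈ A, V (t, 0) = u t
  position_mem : ∀ q ∈ A ×ˢ Set.Ioo (-r) r, S q ∈ Θ
  hasDerivAt_position : ∀ q ∈ A ×ˢ Set.Ioo (-r) r, HasDerivAt (fun s => S (q.1, s)) (V q) q.2
  hasDerivAt_velocity : ∀ q ∈ A ×ˢ Set.Ioo (-r) r,
    HasDerivAt (fun s => V (q.1, s)) (-Γ (S q) (V q) (V q)) q.2

variable {Γ : E → E →L[ℝ] E →L[ℝ] E} {Θ : Set E} {g u : ℝ → E} {A : Set ℝ}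

lemma exists_isCoordGeodesicFamilyOn [CompleteSpace E] (hΘ : IsOpen Θ) (hΓ : ContDiffOn ℝ ∞ Γ Θ)
    (hA : IsOpen A) {t₀ : ℝ} (ht₀ : t₀ ∈ A) (hg : ContDiffOn ℝ ∞ g A) (hgΘ : g t₀ ∈ Θ)
    (hu : ContDiffOn ℝ ∞ u A) :
    ∃ A' ⊆ A, IsOpen A' ∧ t₀ ∈ A' ∧ ∃ r > 0, ∃ S V : ℝ × ℝ → E,
      IsCoordGeodesicFamilyOn Γ Θ g u A' r S V := by
  obtain ⟨r, hr, Φ, hΦ, hΦ0, hΦd⟩ := exists_contDiffOn_flow (hΘ.prod isOpen_univ)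
    (contDiffOn_spray hΓ) (y₀ := (g t₀, u t₀)) ⟨hgΘ, Set.mem_univ _⟩
  have hgu : ContDiffOn ℝ ∞ (fun t => (g t, u t)) A := hg.prodMk hu
  set A' : Set ℝ := A ∩ (fun t => (g t, u t)) ⁻¹' Metric.ball (g t₀, u t₀) r
  have hψ : ContDiffOn ℝ ∞ (fun q : ℝ × ℝ => Φ ((g q.1, u q.1), q.2)) (A' ×ˢ Set.Ioo (-r) r) := by
    refine hΦ.comp (f := fun q : ℝ × ℝ => ((g q.1, u q.1), q.2)) ?_ fun q hq => ⟨hq.1.2, hq.2⟩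
    exact (hgu.comp contDiff_fst.contDiffOn fun q hq => hq.1.1).prodMk contDiff_snd.contDiffOn
  exact ⟨A', Set.inter_subset_left, hgu.continuousOn.isOpen_inter_preimage hA Metric.isOpen_ball,
    ⟨ht₀, Metric.mem_ball_self hr⟩, r, hr, fun q => (Φ ((g q.1, u q.1), q.2)).1,
    fun q => (Φ ((g q.1, u q.1), q.2)).2,
    { contDiffOn_position := contDiff_fst.comp_contDiffOn hψ
      contDiffOn_velocity := contDiff_snd.comp_contDiffOn hψ
      position_zero := fun t ht => congrArg Prod.fst (hΦ0 _ ht.2)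
      velocity_zero := fun t ht => congrArg Prod.snd (hΦ0 _ ht.2)
      position_mem := fun q hq => (hΦd _ hq.1.2 _ hq.2).1.1
      hasDerivAt_position := fun q hq => (hΦd _ hq.1.2 _ hq.2).2.fst
      hasDerivAt_velocity := fun q hq => (hΦd _ hq.1.2 _ hq.2).2.snd }⟩

namespace IsCoordGeodesicFamilyOn

variable {r : ℝ} {S V : ℝ × ℝ → E}

lemma fderiv_position_vertical (h : IsCoordGeodesicFamilyOn Γ Θ g u A r S V) (hA : IsOpen A)
    {q : ℝ × ℝ} (hq : q ∈ A ×ˢ Set.Ioo (-r) r) : fderiv ℝ S q (0, 1) = V q :=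
  (hasDerivAt_vertical (hA.prod isOpen_Ioo) h.contDiffOn_position hq).unique
    (h.hasDerivAt_position q hq)

lemma fderiv_position_horizontal_zero (h : IsCoordGeodesicFamilyOn Γ Θ g u A r S V)
    (hA : IsOpen A) (hr : 0 < r) {t : ℝ} (ht : t ∈ A) :
    fderiv ℝ S (t, 0) (1, 0) = deriv g t := by
  rw [← ((show Set.EqOn (fun t => S (t, 0)) g A from h.position_zero).eventuallyEq_of_mem
    (hA.mem_nhds ht)).deriv_eq]
  exact (hasDerivAt_horizontal (hA.prod isOpen_Ioo) h.contDiffOn_position (q := (t, 0))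
    ⟨ht, neg_lt_zero.mpr hr, hr⟩).deriv.symm

lemma fderiv_velocity_horizontal_zero (h : IsCoordGeodesicFamilyOn Γ Θ g u A r S V)
    (hA : IsOpen A) (hr : 0 < r) {t : ℝ} (ht : t ∈ A) :
    fderiv ℝ V (t, 0) (1, 0) = deriv u t := by
  rw [← ((show Set.EqOn (fun t => V (t, 0)) u A from h.velocity_zero).eventuallyEq_of_mem
    (hA.mem_nhds ht)).deriv_eq]
  exact (hasDerivAt_horizontal (hA.prod isOpen_Ioo) h.contDiffOn_velocity (q := (t, 0))
    ⟨ht, neg_lt_zero.mpr hr, hr⟩).deriv.symm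

lemma connDeriv_eq_zero (h : IsCoordGeodesicFamilyOn Γ Θ g u A r S V) {q : ℝ × ℝ}
    (hq : q ∈ A ×ˢ Set.Ioo (-r) r) :
    connDeriv (connAlong Γ fun s => S (q.1, s)) (deriv fun s => S (q.1, s)) q.2 = 0 := by
  have hderiv : Set.EqOn (deriv fun s => S (q.1, s)) (fun s => V (q.1, s)) (Set.Ioo (-r) r) :=
    fun s hs => (h.hasDerivAt_position (q.1, s) ⟨hq.1, hs⟩).deriv
  rw [eqOn_connDeriv isOpen_Ioo hderiv hq.2, connDeriv, (h.hasDerivAt_velocity q hq).deriv,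
    connAlong, hderiv hq.2]
  exact neg_add_cancel _

lemma exists_fderiv_horizontal_eq [CompleteSpace E]
    (h : IsCoordGeodesicFamilyOn Γ Θ g u A r S V) (hA : IsOpen A) (hr : 0 < r) {a : ℝ → ℝ}
    (ha : ContDiffOn ℝ ∞ a A) (hga : ∀ t ∈ A, deriv g t = a t • u t) :
    ∃ W : ℝ × ℝ → E, ContDiffOn ℝ ∞ W (A ×ˢ Set.Ioo (-r) r) ∧
      ∀ q ∈ A ×ˢ Set.Ioo (-r) r, fderiv ℝ S q (1, 0) = a q.1 • V q + q.2 • W q := by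
  have haQ : ContDiffOn ℝ ∞ (fun q : ℝ × ℝ => a q.1) (A ×ˢ Set.Ioo (-r) r) :=
    ha.comp contDiff_fst.contDiffOn fun q hq => hq.1
  have hdefect : ContDiffOn ℝ ∞ (fun q => fderiv ℝ S q (1, 0) - a q.1 • V q)
      (A ×ˢ Set.Ioo (-r) r) :=
    (contDiffOn_fderiv_apply_const (hA.prod isOpen_Ioo) h.contDiffOn_position _).sub
      (haQ.smul h.contDiffOn_velocity)
  obtain ⟨W, hW, hWeq⟩ := exists_contDiffOn_eq_smul_of_eq_zero hA hdefect fun t ht => by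
    rw [h.fderiv_position_horizontal_zero hA hr ht, h.velocity_zero t ht, hga t ht, sub_self]
  exact ⟨W, hW, fun q hq => by rw [← hWeq q hq, add_sub_cancel]⟩

-- Differentiate `∂S/∂t = a V + s W` along `s` at `s = 0`, with `∂²S/∂s∂t = ∂V/∂t`. As `g'` is
-- parallel to `u`, the term `Γ u g'` of the geodesic equation is also `Γ g' u`.
lemma eq_connDeriv_of_fderiv_horizontal_eq (h : IsCoordGeodesicFamilyOn Γ Θ g u A r S V)
    (hA : IsOpen A) (hr : 0 < r) {a : ℝ → ℝ} (hga : ∀ t ∈ A, deriv g t = a t • u t)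
    {W : ℝ × ℝ → E} (hW : ContDiffOn ℝ ∞ W (A ×ˢ Set.Ioo (-r) r))
    (hSW : ∀ q ∈ A ×ˢ Set.Ioo (-r) r, fderiv ℝ S q (1, 0) = a q.1 • V q + q.2 • W q)
    {t : ℝ} (ht : t ∈ A) : W (t, 0) = connDeriv (connAlong Γ g) u t := by
  have hQ : IsOpen (A ×ˢ Set.Ioo (-r) r) := hA.prod isOpen_Ioo
  have h0 : (0 : ℝ) ∈ Set.Ioo (-r) r := ⟨neg_lt_zero.mpr hr, hr⟩
  have hq : (t, (0 : ℝ)) ∈ A ×ˢ Set.Ioo (-r) r := ⟨ht, h0⟩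
  have hmixed : fderiv ℝ (fun q => fderiv ℝ S q (1, 0)) (t, 0) (0, 1) = deriv u t := by
    have hSV : Set.EqOn (fun q => fderiv ℝ S q (0, 1)) V (A ×ˢ Set.Ioo (-r) r) :=
      fun q hq => h.fderiv_position_vertical hA hq
    rw [fderiv_fderiv_apply_comm hQ h.contDiffOn_position hq,
      (hSV.eventuallyEq_of_mem (hQ.mem_nhds hq)).fderiv_eq,
      h.fderiv_velocity_horizontal_zero hA hr ht]
  have hleft := hasDerivAt_vertical hQ
    (contDiffOn_fderiv_apply_const hQ h.contDiffOn_position (1, 0)) hq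
  have hright := ((hasDerivAt_const (0 : ℝ) (a t)).smul (h.hasDerivAt_velocity _ hq)).add
    ((hasDerivAt_id (0 : ℝ)).smul (hasDerivAt_vertical hQ hW hq))
  have hderiv := hleft.unique (hright.congr_of_eventuallyEq
    (Filter.eventually_of_mem (isOpen_Ioo.mem_nhds h0) fun s hs => hSW (t, s) ⟨ht, hs⟩))
  rw [hmixed, h.position_zero t ht, h.velocity_zero t ht] at hderiv
  rw [connDeriv, connAlong, hderiv, hga t ht]
  simp

end IsCoordGeodesicFamilyOn

end CoordinateSurface

/-! ### Components of tangent vectors -/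

section Components

variable {E : Type*} [NormedAddCommGroup E] [NormedSpace ℝ E]
  {M : Type*} [TopologicalSpace M] [ChartedSpace E M] {x₀ x : M}

lemma extChartAt_symm_mem_chart_source {y : E} (hy : y ∈ (extChartAt 𝓘(ℝ, E) x₀).target) :
    (extChartAt 𝓘(ℝ, E) x₀).symm y ∈ (chartAt E x₀).source := by
  simpa only [extChartAt_source] using (extChartAt 𝓘(ℝ, E) x₀).map_target hy

variable [IsManifold 𝓘(ℝ, E) ∞ M] {P : Type*} [NormedAddCommGroup P] [NormedSpace ℝ P]

lemma coordComponents_eq (hx : x ∈ (chartAt E x₀).source) (v : TangentSpace 𝓘(ℝ, E) x) :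
    coordComponents x₀ v =
      (trivializationAt E (TangentSpace 𝓘(ℝ, E) : M → Type _) x₀).continuousLinearMapAt ℝ x v :=
  (Bundle.Trivialization.continuousLinearMapAt_apply_of_mem ℝ _ hx v).symm

lemma coordField_eq (hx : x ∈ (chartAt E x₀).source) (e : E) :
    coordField x₀ e x =
      (trivializationAt E (TangentSpace 𝓘(ℝ, E) : M → Type _) x₀).symmL ℝ x e :=
  (Bundle.Trivialization.symmL_apply _ hx e).symm

lemma coordComponents_coordField (hx : x ∈ (chartAt E x₀).source) (e : E) :
    coordComponents x₀ (coordField x₀ e x) = e := by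
  rw [coordComponents_eq hx, coordField_eq hx]
  exact Bundle.Trivialization.continuousLinearMapAt_symmL _ hx e

lemma coordField_coordComponents (hx : x ∈ (chartAt E x₀).source) (v : TangentSpace 𝓘(ℝ, E) x) :
    coordField x₀ (coordComponents x₀ v) x = v := by
  rw [coordComponents_eq hx, coordField_eq hx]
  exact Bundle.Trivialization.symmL_continuousLinearMapAt _ hx v

lemma coordComponents_add (hx : x ∈ (chartAt E x₀).source) (v w : TangentSpace 𝓘(ℝ, E) x) :
    coordComponents x₀ (v + w) = coordComponents x₀ v + coordComponents x₀ w := by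
  simp only [coordComponents_eq hx, map_add]

lemma coordComponents_smul (hx : x ∈ (chartAt E x₀).source) (c : ℝ) (v : TangentSpace 𝓘(ℝ, E) x) :
    coordComponents x₀ (c • v) = c • coordComponents x₀ v := by
  simp only [coordComponents_eq hx, map_smul]

lemma coordComponents_zero (hx : x ∈ (chartAt E x₀).source) :
    coordComponents x₀ (0 : TangentSpace 𝓘(ℝ, E) x) = 0 := by
  simp only [coordComponents_eq hx, map_zero]

lemma coordComponents_injective (hx : x ∈ (chartAt E x₀).source) :
    Function.Injective (coordComponents x₀ : TangentSpace 𝓘(ℝ, E) x → E) :=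
  Function.LeftInverse.injective (coordField_coordComponents hx)

lemma linearIndependent_coordComponents_iff (hx : x ∈ (chartAt E x₀).source)
    (v w : TangentSpace 𝓘(ℝ, E) x) :
    LinearIndependent ℝ ![coordComponents x₀ v, coordComponents x₀ w] ↔
      LinearIndependent ℝ ![v, w] := by
  let L : TangentSpace 𝓘(ℝ, E) x →ₗ[ℝ] E :=
    { toFun := coordComponents x₀
      map_add' := coordComponents_add hx
      map_smul' := coordComponents_smul hx }
  have hL : ![coordComponents x₀ v, coordComponents x₀ w] = L ∘ ![v, w] := by
    ext i
    fin_cases i <;> rfl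
  rw [hL, L.linearIndependent_iff (LinearMap.ker_eq_bot.mpr (coordComponents_injective hx))]

lemma coordComponents_mfderiv {f : P → M} {q : P}
    (hf : MDifferentiableAt 𝓘(ℝ, P) 𝓘(ℝ, E) f q) (hx : f q ∈ (chartAt E x₀).source) (ξ : P) :
    coordComponents x₀ (mfderiv 𝓘(ℝ, P) 𝓘(ℝ, E) f q ξ)
      = fderiv ℝ (fun p => extChartAt 𝓘(ℝ, E) x₀ (f p)) q ξ := by
  rw [coordComponents_eq hx, TangentBundle.continuousLinearMapAt_trivializationAt hx,
    ← mfderiv_eq_fderiv]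
  exact (congrArg (fun L => L ξ) (mfderiv_comp q (mdifferentiableAt_extChartAt hx) hf)).symm

lemma coordComponents_velocity {γ : ℝ → M} {t : ℝ}
    (hγ : MDifferentiableAt 𝓘(ℝ, ℝ) 𝓘(ℝ, E) γ t) (hx : γ t ∈ (chartAt E x₀).source) :
    coordComponents x₀ (velocity γ t) = deriv (fun τ => extChartAt 𝓘(ℝ, E) x₀ (γ τ)) t :=
  coordComponents_mfderiv hγ hx 1

lemma contMDiffOn_coordField (x₀ : M) (e : E) :
    ContMDiffOn 𝓘(ℝ, E) 𝓘(ℝ, E).tangent ∞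
      (fun x => (⟨x, coordField x₀ e x⟩ : TangentBundle 𝓘(ℝ, E) M)) (chartAt E x₀).source := by
  refine ((trivializationAt E (TangentSpace 𝓘(ℝ, E) : M → Type _)
    x₀).contMDiffOn_section_baseSet_iff).mpr ?_
  exact (contMDiffOn_const (c := e)).congr fun x hx => coordComponents_coordField hx e

lemma mdifferentiableAt_coordField (hx : x ∈ (chartAt E x₀).source) (e : E) :
    MDifferentiableAt 𝓘(ℝ, E) 𝓘(ℝ, E).tangent
      (fun x => (⟨x, coordField x₀ e x⟩ : TangentBundle 𝓘(ℝ, E) M)) x :=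
  ((contMDiffOn_coordField x₀ e).contMDiffAt
    ((chartAt E x₀).open_source.mem_nhds hx)).mdifferentiableAt (by simp)

lemma mdifferentiableAt_coordComponents (hx : x ∈ (chartAt E x₀).source)
    {X : ∀ x : M, TangentSpace 𝓘(ℝ, E) x}
    (hX : MDifferentiableAt 𝓘(ℝ, E) 𝓘(ℝ, E).tangent
      (fun x => (⟨x, X x⟩ : TangentBundle 𝓘(ℝ, E) M)) x) :
    MDifferentiableAt 𝓘(ℝ, E) 𝓘(ℝ, E) (fun y => coordComponents x₀ (X y)) x :=
  ((trivializationAt E (TangentSpace 𝓘(ℝ, E) : M → Type _)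
    x₀).mdifferentiableAt_section_iff 𝓘(ℝ, E) _ hx).mp hX

lemma contMDiffOn_tangentBundle_iff {f : P → M} {X : ∀ q, TangentSpace 𝓘(ℝ, E) (f q)} {U : Set P}
    (hU : ∀ q ∈ U, f q ∈ (chartAt E x₀).source) :
    ContMDiffOn 𝓘(ℝ, P) 𝓘(ℝ, E).tangent ∞
      (fun q => (⟨f q, X q⟩ : TangentBundle 𝓘(ℝ, E) M)) U ↔
    ContMDiffOn 𝓘(ℝ, P) 𝓘(ℝ, E) ∞ f U ∧ ContDiffOn ℝ ∞ (fun q => coordComponents x₀ (X q)) U := by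
  rw [← contMDiffOn_iff_contDiffOn]
  exact (trivializationAt E (TangentSpace 𝓘(ℝ, E) : M → Type _) x₀).contMDiffOn_iff hU

lemma tangentBundle_ext_of_coordComponents {p q : TangentBundle 𝓘(ℝ, E) M}
    (hp : p.1 ∈ (chartAt E x₀).source) (hpq : p.1 = q.1)
    (h : coordComponents x₀ p.2 = coordComponents x₀ q.2) : p = q :=
  (trivializationAt E (TangentSpace 𝓘(ℝ, E) : M → Type _) x₀).toOpenPartialHomeomorph.injOn
    hp (hpq ▸ hp : q.1 ∈ (chartAt E x₀).source) (Prod.ext hpq h)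

lemma contDiffOn_extChartAt_comp {f : P → M} {U : Set P} (hf : ContMDiffOn 𝓘(ℝ, P) 𝓘(ℝ, E) ∞ f U)
    (hU : ∀ q ∈ U, f q ∈ (chartAt E x₀).source) :
    ContDiffOn ℝ ∞ (fun q => extChartAt 𝓘(ℝ, E) x₀ (f q)) U := by
  rw [← contMDiffOn_iff_contDiffOn]
  exact (contMDiffOn_extChartAt (x := x₀)).comp hf hU

lemma contMDiffOn_extChartAt_symm_comp {S : P → E} {U : Set P} (hS : ContDiffOn ℝ ∞ S U)
    (hU : ∀ q ∈ U, S q ∈ (extChartAt 𝓘(ℝ, E) x₀).target) :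
    ContMDiffOn 𝓘(ℝ, P) 𝓘(ℝ, E) ∞ (fun q => (extChartAt 𝓘(ℝ, E) x₀).symm (S q)) U :=
  (contMDiffOn_extChartAt_symm x₀).comp hS.contMDiffOn hU

end Components

/-! ### Christoffel symbols -/

section Christoffel

variable {E : Type*} [NormedAddCommGroup E] [NormedSpace ℝ E]
  {M : Type*} [TopologicalSpace M] [ChartedSpace E M] {x₀ x : M}

lemma mvfderiv_congr_of_eventuallyEq {f g : M → E} (h : f =ᶠ[𝓝 x] g) :
    mvfderiv 𝓘(ℝ, E) f x = mvfderiv 𝓘(ℝ, E) g x := by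
  ext v
  simp only [mvfderiv]
  exact congrArg (fun L : TangentSpace 𝓘(ℝ, E) x →L[ℝ] E => L v) h.mfderiv_eq

variable [IsManifold 𝓘(ℝ, E) ∞ M]

/-- The flat connection of the preferred chart at `x₀`, for which the coordinate vector fields are
parallel. The Christoffel symbols measure the difference from it. -/
def flatCov (x₀ : M) (X : ∀ x : M, TangentSpace 𝓘(ℝ, E) x) (x : M) :
    TangentSpace 𝓘(ℝ, E) x →L[ℝ] TangentSpace 𝓘(ℝ, E) x :=
  ((trivializationAt E (TangentSpace 𝓘(ℝ, E) : M → Type _) x₀).symmL ℝ x).comp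
    (mvfderiv 𝓘(ℝ, E) (fun y => coordComponents x₀ (X y)) x)

lemma isCovariantDerivativeOn_flatCov (x₀ : M) :
    IsCovariantDerivativeOn (I := 𝓘(ℝ, E)) (V := (TangentSpace 𝓘(ℝ, E) : M → Type _)) E (flatCov x₀)
      (chartAt E x₀).source where
  add {X Y x} hX hY hx := by
    have hsum : (fun y => coordComponents x₀ ((X + Y) y)) =ᶠ[𝓝 x]
        (fun y => coordComponents x₀ (X y)) + fun y => coordComponents x₀ (Y y) :=
      Filter.eventually_of_mem ((chartAt E x₀).open_source.mem_nhds hx)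
        fun y hy => coordComponents_add hy _ _
    rw [flatCov, mvfderiv_congr_of_eventuallyEq hsum,
      mvfderiv_add (mdifferentiableAt_coordComponents hx hX)
        (mdifferentiableAt_coordComponents hx hY), ContinuousLinearMap.comp_add]
    rfl
  leibniz {X f x} hX hf hx := by
    have hsmul : (fun y => coordComponents x₀ ((f • X) y)) =ᶠ[𝓝 x]
        f • fun y => coordComponents x₀ (X y) :=
      Filter.eventually_of_mem ((chartAt E x₀).open_source.mem_nhds hx)
        fun y hy => coordComponents_smul hy _ _
    rw [flatCov, mvfderiv_congr_of_eventuallyEq hsmul,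
      mvfderiv_smul hf (mdifferentiableAt_coordComponents hx hX)]
    ext v
    simp only [ContinuousLinearMap.comp_apply, add_apply, map_add, flatCov]
    congr 1
    · exact map_smul _ _ _
    · refine (map_smul _ _ _).trans ?_
      rw [← coordField_eq hx, coordField_coordComponents hx]
      rfl

lemma flatCov_coordField (hx : x ∈ (chartAt E x₀).source) (e : E) :
    flatCov x₀ (coordField x₀ e) x = 0 := by
  have hconst : (fun y => coordComponents x₀ (coordField x₀ e y)) =ᶠ[𝓝 x] fun _ => e :=
    Filter.eventually_of_mem ((chartAt E x₀).open_source.mem_nhds hx)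
      fun y hy => coordComponents_coordField hy e
  rw [flatCov, mvfderiv_congr_of_eventuallyEq hconst, mvfderiv_const, ContinuousLinearMap.comp_zero]

variable [FiniteDimensional ℝ E] (cov : AffineConnection E M)

/-- The difference tensor of `∇` and the flat connection of the preferred chart at `x₀`. -/
def christoffelTensor (x₀ x : M) :
    TangentSpace 𝓘(ℝ, E) x →L[ℝ] TangentSpace 𝓘(ℝ, E) x →L[ℝ] TangentSpace 𝓘(ℝ, E) x :=
  (cov.isCovariantDerivativeOnUniv.mono (Set.subset_univ _)).difference
    (isCovariantDerivativeOn_flatCov x₀) x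

lemma christoffelTensor_apply (hx : x ∈ (chartAt E x₀).source)
    {X : ∀ x : M, TangentSpace 𝓘(ℝ, E) x}
    (hX : MDifferentiableAt 𝓘(ℝ, E) 𝓘(ℝ, E).tangent
      (fun x => (⟨x, X x⟩ : TangentBundle 𝓘(ℝ, E) M)) x) :
    christoffelTensor cov x₀ x (X x) = cov X x - flatCov x₀ X x :=
  IsCovariantDerivativeOn.difference_apply _ _ hx hX

lemma christoffelTensor_coordField (hx : x ∈ (chartAt E x₀).source) (e : E) :
    christoffelTensor cov x₀ x (coordField x₀ e x) = cov (coordField x₀ e) x := by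
  rw [christoffelTensor_apply cov hx (mdifferentiableAt_coordField hx e), flatCov_coordField hx,
    sub_zero]

lemma cov_eq_flatCov_add (hx : x ∈ (chartAt E x₀).source) {X : ∀ x : M, TangentSpace 𝓘(ℝ, E) x}
    (hX : MDifferentiableAt 𝓘(ℝ, E) 𝓘(ℝ, E).tangent
      (fun x => (⟨x, X x⟩ : TangentBundle 𝓘(ℝ, E) M)) x) :
    cov X x = flatCov x₀ X x + cov (coordField x₀ (coordComponents x₀ (X x))) x := by
  rw [← christoffelTensor_coordField cov hx, coordField_coordComponents hx,
    christoffelTensor_apply cov hx hX, add_sub_cancel]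

/-- The Christoffel symbols of `∇` in the preferred chart at `x₀`: the components of
`∇_{∑ vⁱ ∂ᵢ} (∑ eⁱ ∂ᵢ)` at the point with the coordinates `y`, as a bilinear map of `e` and `v`, in
this order. Junk outside the target of the chart. -/
def christoffel (x₀ : M) (y : E) : E →L[ℝ] E →L[ℝ] E :=
  let T := trivializationAt E (TangentSpace 𝓘(ℝ, E) : M → Type _) x₀
  let x := (extChartAt 𝓘(ℝ, E) x₀).symm y
  LinearMap.toContinuousLinearMap
    { toFun e := (T.continuousLinearMapAt ℝ x).comp
        ((christoffelTensor cov x₀ x (T.symmL ℝ x e)).comp (T.symmL ℝ x))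
      map_add' e e' := by
        simp only [map_add, ContinuousLinearMap.add_comp, ContinuousLinearMap.comp_add]
      map_smul' c e := by
        simp only [map_smul, ContinuousLinearMap.smul_comp, ContinuousLinearMap.comp_smul]
        rfl }

lemma christoffel_apply_of_mem_target {y : E} (hy : y ∈ (extChartAt 𝓘(ℝ, E) x₀).target) (e v : E) :
    christoffel cov x₀ y e v = coordComponents x₀
      (cov (coordField x₀ e) ((extChartAt 𝓘(ℝ, E) x₀).symm y)
        (coordField x₀ v ((extChartAt 𝓘(ℝ, E) x₀).symm y))) := by
  have hx := extChartAt_symm_mem_chart_source hy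
  rw [← christoffelTensor_coordField cov hx, coordComponents_eq hx, coordField_eq hx,
    coordField_eq hx]
  rfl

lemma christoffel_apply (hx : x ∈ (chartAt E x₀).source) (e : E) (v : TangentSpace 𝓘(ℝ, E) x) :
    christoffel cov x₀ (extChartAt 𝓘(ℝ, E) x₀ x) e (coordComponents x₀ v)
      = coordComponents x₀ (cov (coordField x₀ e) x v) := by
  have hx' : x ∈ (extChartAt 𝓘(ℝ, E) x₀).source := by rwa [extChartAt_source]
  rw [christoffel_apply_of_mem_target cov ((extChartAt 𝓘(ℝ, E) x₀).map_source hx'),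
    (extChartAt 𝓘(ℝ, E) x₀).left_inv hx', coordField_coordComponents hx]

variable [T2Space M] [CovariantDerivative.ContMDiffCovariantDerivative cov ∞]

-- The smoothness of `∇` is known for globally smooth fields, hence the cut-off.
lemma contMDiffAt_cov_of_contMDiffOn {X Y : ∀ x : M, TangentSpace 𝓘(ℝ, E) x} {s : Set M}
    (hs : IsOpen s) (hx : x ∈ s)
    (hX : ContMDiffOn 𝓘(ℝ, E) 𝓘(ℝ, E).tangent ∞
      (fun x => (⟨x, X x⟩ : TangentBundle 𝓘(ℝ, E) M)) s)
    (hY : ContMDiffOn 𝓘(ℝ, E) 𝓘(ℝ, E).tangent ∞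
      (fun x => (⟨x, Y x⟩ : TangentBundle 𝓘(ℝ, E) M)) s) :
    ContMDiffAt 𝓘(ℝ, E) 𝓘(ℝ, E).tangent ∞
      (fun x => (⟨x, cov X x (Y x)⟩ : TangentBundle 𝓘(ℝ, E) M)) x := by
  obtain ⟨χ, -, hχ⟩ := (SmoothBumpFunction.nhds_basis_tsupport (I := 𝓘(ℝ, E)) x).mem_iff.mp
    (hs.mem_nhds hx)
  have hχX : ContMDiff 𝓘(ℝ, E) 𝓘(ℝ, E).tangent ∞
      (fun x => (⟨x, ((χ : M → ℝ) • X) x⟩ : TangentBundle 𝓘(ℝ, E) M)) :=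
    ContMDiffOn.smul_section_of_tsupport χ.contMDiff.contMDiffOn hs hχ hX
  have hcovχX := (CovariantDerivative.ContMDiffCovariantDerivative.contMDiff
    (cov := cov) (k := ∞)).contMDiff (σ := (χ : M → ℝ) • X) hχX.contMDiffOn
  refine ((hcovχX.contMDiffAt (x := x) Filter.univ_mem).clm_bundle_apply
    (hY.contMDiffAt (hs.mem_nhds hx))).congr_of_eventuallyEq ?_
  filter_upwards [hs.mem_nhds hx, χ.eventuallyEq_one.eventually_nhds] with y hy hχy
  have hXy : X =ᶠ[𝓝 y] (χ : M → ℝ) • X := hχy.mono fun z hz => by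
    rw [Pi.smul_apply', hz, Pi.one_apply, one_smul]
  rw [cov.isCovariantDerivativeOnUniv.congr_of_eventuallyEq
    ((hX.contMDiffAt (hs.mem_nhds hy)).mdifferentiableAt (by simp))
    (hχX.mdifferentiable (by simp) y) Filter.univ_mem hXy]

lemma contDiffOn_christoffel (x₀ : M) :
    ContDiffOn ℝ ∞ (christoffel cov x₀) (extChartAt 𝓘(ℝ, E) x₀).target := by
  refine contDiffOn_clm_apply.mpr fun e => contDiffOn_clm_apply.mpr fun v => ?_
  have hcov : ContMDiffOn 𝓘(ℝ, E) 𝓘(ℝ, E) ∞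
      (fun x => coordComponents x₀ (cov (coordField x₀ e) x (coordField x₀ v x)))
      (chartAt E x₀).source :=
    (Bundle.Trivialization.contMDiffOn_section_baseSet_iff
      (trivializationAt E (TangentSpace 𝓘(ℝ, E) : M → Type _) x₀)).mp fun x hx =>
        (contMDiffAt_cov_of_contMDiffOn cov (chartAt E x₀).open_source hx
          (contMDiffOn_coordField x₀ e) (contMDiffOn_coordField x₀ v)).contMDiffWithinAt
  have hcomp := hcov.comp (contMDiffOn_extChartAt_symm x₀)
    fun y hy => extChartAt_symm_mem_chart_source hy
  exact (contMDiffOn_iff_contDiffOn.mp hcomp).congr fun y hy =>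
    christoffel_apply_of_mem_target cov hy e v

end Christoffel

/-! ### Covariant derivatives along curves -/

section AlongCurves

variable {E : Type*} [NormedAddCommGroup E] [NormedSpace ℝ E]
  {M : Type*} [TopologicalSpace M] [ChartedSpace E M] {γ : ℝ → M} {t : ℝ}

lemma deriv_comp_curve {f : M → E} (hf : MDifferentiableAt 𝓘(ℝ, E) 𝓘(ℝ, E) f (γ t))
    (hγ : MDifferentiableAt 𝓘(ℝ, ℝ) 𝓘(ℝ, E) γ t) :
    deriv (fun τ => f (γ τ)) t = mvfderiv 𝓘(ℝ, E) f (γ t) (velocity γ t) := by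
  have hcomp := mfderiv_comp t hf hγ
  rw [mfderiv_eq_fderiv] at hcomp
  exact congrArg (fun L : ℝ →L[ℝ] E => L 1) hcomp

variable [IsManifold 𝓘(ℝ, E) ∞ M] {x₀ x₁ : M} {w : ∀ t : ℝ, TangentSpace 𝓘(ℝ, E) (γ t)}

lemma deriv_coordComponents_eq (hγ : MDifferentiableAt 𝓘(ℝ, ℝ) 𝓘(ℝ, E) γ t)
    (hw : DifferentiableAt ℝ (fun τ => coordComponents x₀ (w τ)) t)
    (hx₀ : γ t ∈ (chartAt E x₀).source) (hx₁ : γ t ∈ (chartAt E x₁).source) :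
    deriv (fun τ => coordComponents x₁ (w τ)) t =
      mvfderiv 𝓘(ℝ, E)
          (fun y => coordComponents x₁ (coordField x₀ (coordComponents x₀ (w t)) y)) (γ t)
          (velocity γ t)
        + coordComponents x₁
          (coordField x₀ (deriv (fun τ => coordComponents x₀ (w τ)) t) (γ t)) := by
  set T₀ := trivializationAt E (TangentSpace 𝓘(ℝ, E) : M → Type _) x₀
  set T₁ := trivializationAt E (TangentSpace 𝓘(ℝ, E) : M → Type _) x₁
  let A : M → E →L[ℝ] E := fun x => (T₀.coordChangeL ℝ T₁ x : E →L[ℝ] E)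
  set e := coordComponents x₀ (w t)
  have hA : ∀ x ∈ (chartAt E x₀).source ∩ (chartAt E x₁).source, ∀ e : E,
      A x e = coordComponents x₁ (coordField x₀ e x) := fun x hx e => T₀.coordChangeL_apply T₁ hx e
  have hmem : ∀ᶠ τ in 𝓝 t, γ τ ∈ (chartAt E x₀).source ∩ (chartAt E x₁).source :=
    hγ.continuousAt.eventually
      (((chartAt E x₀).open_source.inter (chartAt E x₁).open_source).mem_nhds ⟨hx₀, hx₁⟩)
  have hAγ : DifferentiableAt ℝ (fun τ => A (γ τ)) t :=
    (((contMDiffAt_coordChangeL (IB := 𝓘(ℝ, E)) (n := ∞) (e := T₀) (e' := T₁)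
      hx₀ hx₁).mdifferentiableAt (by simp)).comp t hγ).differentiableAt
  have hw₁ : (fun τ => coordComponents x₁ (w τ)) =ᶠ[𝓝 t]
      fun τ => A (γ τ) (coordComponents x₀ (w τ)) :=
    hmem.mono fun τ hτ => by simp only [hA _ hτ, coordField_coordComponents hτ.1]
  have hAe : deriv (fun τ => A (γ τ)) t e =
      mvfderiv 𝓘(ℝ, E) (fun y => coordComponents x₁ (coordField x₀ e y)) (γ t)
        (velocity γ t) := by
    have hfield : (fun τ => A (γ τ) e) =ᶠ[𝓝 t]
        fun τ => coordComponents x₁ (coordField x₀ e (γ τ)) :=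
      hmem.mono fun τ hτ => hA _ hτ e
    rw [← deriv_comp_curve
      (mdifferentiableAt_coordComponents hx₁ (mdifferentiableAt_coordField hx₀ e)) hγ,
      ← hfield.deriv_eq]
    simpa using (hAγ.hasDerivAt.clm_apply (hasDerivAt_const t e)).deriv.symm
  rw [hw₁.deriv_eq, (hAγ.hasDerivAt.clm_apply hw.hasDerivAt).deriv, hAe, hA _ ⟨hx₀, hx₁⟩]

variable [FiniteDimensional ℝ E] (cov : AffineConnection E M)

lemma covDerivAlongInChart_eq_of_mem_source (hγ : MDifferentiableAt 𝓘(ℝ, ℝ) 𝓘(ℝ, E) γ t)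
    (hw : DifferentiableAt ℝ (fun τ => coordComponents x₀ (w τ)) t)
    (hx₀ : γ t ∈ (chartAt E x₀).source) (hx₁ : γ t ∈ (chartAt E x₁).source) :
    covDerivAlongInChart cov x₁ γ w t = covDerivAlongInChart cov x₀ γ w t := by
  have hcov := congrArg (fun L => L (velocity γ t))
    (cov_eq_flatCov_add cov hx₁ (mdifferentiableAt_coordField hx₀ (coordComponents x₀ (w t))))
  simp only [coordField_coordComponents hx₀, flatCov, add_apply,
    ContinuousLinearMap.comp_apply, ← coordField_eq hx₁] at hcov
  rw [covDerivAlongInChart, covDerivAlongInChart, deriv_coordComponents_eq hγ hw hx₀ hx₁, hcov,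
    coordField_eq hx₁, map_add, ← coordField_eq hx₁, ← coordField_eq hx₁,
    coordField_coordComponents hx₁]
  abel

lemma coordComponents_covDerivAlong (hγ : MDifferentiableAt 𝓘(ℝ, ℝ) 𝓘(ℝ, E) γ t)
    (hw : DifferentiableAt ℝ (fun τ => coordComponents x₀ (w τ)) t)
    (hx₀ : γ t ∈ (chartAt E x₀).source) :
    coordComponents x₀ (covDerivAlong cov γ w t) =
      connDeriv (connAlong (christoffel cov x₀) fun τ => extChartAt 𝓘(ℝ, E) x₀ (γ τ))
        (fun τ => coordComponents x₀ (w τ)) t := by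
  rw [covDerivAlong, covDerivAlongInChart_eq_of_mem_source cov hγ hw hx₀
    (mem_chart_source E (γ t)), covDerivAlongInChart, coordComponents_add hx₀,
    coordComponents_coordField hx₀, ← christoffel_apply cov hx₀,
    coordComponents_velocity hγ hx₀]
  rfl

variable [T2Space M] [CovariantDerivative.ContMDiffCovariantDerivative cov ∞] {A : Set ℝ}

lemma contDiffOn_connAlong_christoffel (hA : IsOpen A) (hγ : ContMDiffOn 𝓘(ℝ, ℝ) 𝓘(ℝ, E) ∞ γ A)
    (hAx : ∀ t ∈ A, γ t ∈ (chartAt E x₀).source) :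
    ContDiffOn ℝ ∞
      (connAlong (christoffel cov x₀) fun τ => extChartAt 𝓘(ℝ, E) x₀ (γ τ)) A :=
  contDiffOn_connAlong (contDiffOn_christoffel cov x₀) hA (contDiffOn_extChartAt_comp hγ hAx)
    fun t ht => (extChartAt 𝓘(ℝ, E) x₀).map_source (by simpa using hAx t ht)

lemma eqOn_coordComponents_iterNabla (hA : IsOpen A) (hγ : ContMDiffOn 𝓘(ℝ, ℝ) 𝓘(ℝ, E) ∞ γ A)
    (hAx : ∀ t ∈ A, γ t ∈ (chartAt E x₀).source) (i : ℕ) :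
    Set.EqOn (fun t => coordComponents x₀ (iterNabla cov γ (i + 1) t))
      ((connDeriv (connAlong (christoffel cov x₀) fun τ => extChartAt 𝓘(ℝ, E) x₀ (γ τ)))^[i]
        (deriv fun τ => extChartAt 𝓘(ℝ, E) x₀ (γ τ))) A := by
  have hmdiff : ∀ t ∈ A, MDifferentiableAt 𝓘(ℝ, ℝ) 𝓘(ℝ, E) γ t := fun t ht =>
    (hγ.contMDiffAt (hA.mem_nhds ht)).mdifferentiableAt (by simp)
  have hB := contDiffOn_connAlong_christoffel cov hA hγ hAx
  have hg' := ((contDiffOn_infty_iff_deriv_of_isOpen hA).mp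
    (contDiffOn_extChartAt_comp hγ hAx)).2
  induction i with
  | zero => exact fun t ht => coordComponents_velocity (hmdiff t ht) (hAx t ht)
  | succ i ih =>
    rw [Function.iterate_succ_apply']
    refine Set.EqOn.trans (fun t ht => ?_) (eqOn_connDeriv hA ih)
    have hsmooth := (contDiffOn_iterate_connDeriv hA hB hg' i).congr ih
    exact coordComponents_covDerivAlong cov (hmdiff t ht)
      (differentiableAt_of_contDiffOn hA hsmooth ht) (hAx t ht)

end AlongCurves

/-! ### Geodesics -/

section Geodesics

lemma eventuallyEq_of_hasDerivAt_of_contDiffAt {F : Type*} [NormedAddCommGroup F]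
    [NormedSpace ℝ F] {X : F → F} {f g : ℝ → F} {t : ℝ} (hX : ContDiffAt ℝ 1 X (f t))
    (hf : ∀ᶠ τ in 𝓝 t, HasDerivAt f (X (f τ)) τ) (hg : ∀ᶠ τ in 𝓝 t, HasDerivAt g (X (g τ)) τ)
    (hfg : f t = g t) : f =ᶠ[𝓝 t] g := by
  obtain ⟨K, s, hs, hLip⟩ := hX.exists_lipschitzOnWith
  exact ODE_solution_unique_of_eventually (v := fun _ => X) (s := fun _ => s)
    (Filter.Eventually.of_forall fun _ => hLip)
    (hf.and (hf.self_of_nhds.continuousAt.eventually_mem hs))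
    (hg.and (hg.self_of_nhds.continuousAt.eventually_mem (hfg ▸ hs))) hfg

variable {E : Type*} [NormedAddCommGroup E] [NormedSpace ℝ E]
  {M : Type*} [TopologicalSpace M] [ChartedSpace E M] {x₀ : M}

/-- The lift of a curve to position and velocity, in the preferred chart at `x₀`. The lift of a
geodesic is an integral curve of the geodesic spray. -/
def phaseCurve (x₀ : M) (c : ℝ → M) (t : ℝ) : E × E :=
  (extChartAt 𝓘(ℝ, E) x₀ (c t), deriv (fun τ => extChartAt 𝓘(ℝ, E) x₀ (c τ)) t)

lemma phaseCurve_eq_of_eventuallyEq {c₁ c₂ : ℝ → M} {t : ℝ} (h : c₁ =ᶠ[𝓝 t] c₂) :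
    phaseCurve (E := E) x₀ c₁ t = phaseCurve x₀ c₂ t :=
  Prod.ext (congrArg (extChartAt 𝓘(ℝ, E) x₀) h.eq_of_nhds)
    (h.fun_comp (extChartAt 𝓘(ℝ, E) x₀)).deriv_eq

lemma eventuallyEq_of_eventuallyEq_phaseCurve {c₁ c₂ : ℝ → M} {t : ℝ}
    (h₁ : ∀ᶠ τ in 𝓝 t, c₁ τ ∈ (chartAt E x₀).source)
    (h₂ : ∀ᶠ τ in 𝓝 t, c₂ τ ∈ (chartAt E x₀).source)
    (h : phaseCurve (E := E) x₀ c₁ =ᶠ[𝓝 t] phaseCurve x₀ c₂) : c₁ =ᶠ[𝓝 t] c₂ := by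
  filter_upwards [h, h₁, h₂] with τ hτ hτ₁ hτ₂
  exact (extChartAt 𝓘(ℝ, E) x₀).injOn (by rwa [extChartAt_source]) (by rwa [extChartAt_source])
    (congrArg Prod.fst hτ)

variable [IsManifold 𝓘(ℝ, E) ∞ M]

lemma phaseCurve_eq_of_velocity_eq {c₁ c₂ : ℝ → M} {t : ℝ}
    (h₁ : MDifferentiableAt 𝓘(ℝ, ℝ) 𝓘(ℝ, E) c₁ t) (h₂ : MDifferentiableAt 𝓘(ℝ, ℝ) 𝓘(ℝ, E) c₂ t)
    (hx : c₁ t ∈ (chartAt E x₀).source)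
    (h : (⟨c₁ t, velocity c₁ t⟩ : TangentBundle 𝓘(ℝ, E) M) = ⟨c₂ t, velocity c₂ t⟩) :
    phaseCurve (E := E) x₀ c₁ t = phaseCurve x₀ c₂ t := by
  have hpos : c₁ t = c₂ t := congrArg Bundle.TotalSpace.proj h
  refine Prod.ext (congrArg (extChartAt 𝓘(ℝ, E) x₀) hpos) ?_
  refine (coordComponents_velocity h₁ hx).symm.trans (Eq.trans ?_
    (coordComponents_velocity h₂ (hpos ▸ hx)))
  exact congrArg (fun p => (trivializationAt E (TangentSpace 𝓘(ℝ, E) : M → Type _) x₀ p).2) h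

variable {cov : AffineConnection E M}

lemma IsGeodesicOn.mono {c : ℝ → M} {J J' : Set ℝ} (hc : IsGeodesicOn cov c J) (hJ : J' ⊆ J) :
    IsGeodesicOn cov c J' :=
  ⟨hc.1.mono hJ, fun s hs => hc.2 s (hJ hs)⟩

lemma IsGeodesicOn.mdifferentiableAt {c : ℝ → M} {J : Set ℝ} (hc : IsGeodesicOn cov c J)
    (hJ : IsOpen J) {t : ℝ} (ht : t ∈ J) : MDifferentiableAt 𝓘(ℝ, ℝ) 𝓘(ℝ, E) c t :=
  (hc.1.contMDiffAt (hJ.mem_nhds ht)).mdifferentiableAt (by simp)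

variable [FiniteDimensional ℝ E] [T2Space M]
  [CovariantDerivative.ContMDiffCovariantDerivative cov ∞]

lemma IsGeodesicOn.hasDerivAt_phaseCurve {c : ℝ → M} {J : Set ℝ} (hc : IsGeodesicOn cov c J)
    (hJ : IsOpen J) {t : ℝ} (ht : t ∈ J) (hx : c t ∈ (chartAt E x₀).source) :
    HasDerivAt (phaseCurve x₀ c) (spray (christoffel cov x₀) (phaseCurve x₀ c t)) t := by
  have hA : IsOpen (J ∩ c ⁻¹' (chartAt E x₀).source) :=
    hc.1.continuousOn.isOpen_inter_preimage hJ (chartAt E x₀).open_source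
  have hcA := hc.1.mono (Set.inter_subset_left (t := c ⁻¹' (chartAt E x₀).source))
  have hg := contDiffOn_extChartAt_comp hcA fun τ hτ => hτ.2
  have hacc := eqOn_coordComponents_iterNabla cov hA hcA (fun τ hτ => hτ.2) 1 ⟨ht, hx⟩
  simp only [hc.2 t ht, coordComponents_zero hx, Function.iterate_one, connDeriv] at hacc
  have hvel := (differentiableAt_of_contDiffOn hA hg ⟨ht, hx⟩).hasDerivAt
  have hacc' := (differentiableAt_of_contDiffOn hA
    ((contDiffOn_infty_iff_deriv_of_isOpen hA).mp hg).2 ⟨ht, hx⟩).hasDerivAt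
  rw [eq_neg_of_add_eq_zero_left hacc.symm] at hacc'
  exact hvel.prodMk hacc'

lemma IsGeodesicOn.eventuallyEq_of_phaseCurve_eq {c₁ c₂ : ℝ → M} {J : Set ℝ}
    (h₁ : IsGeodesicOn cov c₁ J) (h₂ : IsGeodesicOn cov c₂ J) (hJ : IsOpen J) {t : ℝ} (ht : t ∈ J)
    (hx₁ : c₁ t ∈ (chartAt E x₀).source) (hx₂ : c₂ t ∈ (chartAt E x₀).source)
    (heq : phaseCurve (E := E) x₀ c₁ t = phaseCurve x₀ c₂ t) : c₁ =ᶠ[𝓝 t] c₂ := by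
  have hmem {c : ℝ → M} (hc : IsGeodesicOn cov c J) (hx : c t ∈ (chartAt E x₀).source) :
      ∀ᶠ τ in 𝓝 t, τ ∈ J ∧ c τ ∈ (chartAt E x₀).source :=
    (hJ.eventually_mem ht).and ((hc.mdifferentiableAt hJ ht).continuousAt.eventually_mem
      ((chartAt E x₀).open_source.mem_nhds hx))
  have hspray : ContDiffAt ℝ 1 (spray (christoffel cov x₀)) (phaseCurve x₀ c₁ t) :=
    ((contDiffOn_spray (contDiffOn_christoffel cov x₀)).contDiffAt
      (((isOpen_extChartAt_target x₀).prod isOpen_univ).mem_nhds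
        ⟨(extChartAt 𝓘(ℝ, E) x₀).map_source (by rwa [extChartAt_source]),
          Set.mem_univ _⟩)).of_le (by simp)
  exact eventuallyEq_of_eventuallyEq_phaseCurve ((hmem h₁ hx₁).mono fun _ h => h.2)
    ((hmem h₂ hx₂).mono fun _ h => h.2) (eventuallyEq_of_hasDerivAt_of_contDiffAt hspray
      ((hmem h₁ hx₁).mono fun _ h => h₁.hasDerivAt_phaseCurve hJ h.1 h.2)
      ((hmem h₂ hx₂).mono fun _ h => h₂.hasDerivAt_phaseCurve hJ h.1 h.2) heq)

-- The set where two geodesics have the same germ is open and, by uniqueness for the spray, closed.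
lemma IsGeodesicOn.eqOn {c₁ c₂ : ℝ → M} {J : Set ℝ} (h₁ : IsGeodesicOn cov c₁ J)
    (h₂ : IsGeodesicOn cov c₂ J) (hJ : IsOpen J) (hJc : J.OrdConnected) (h0 : (0 : ℝ) ∈ J)
    (hinit : (⟨c₁ 0, velocity c₁ 0⟩ : TangentBundle 𝓘(ℝ, E) M) = ⟨c₂ 0, velocity c₂ 0⟩) :
    Set.EqOn c₁ c₂ J := by
  suffices h : J ⊆ {t | c₁ =ᶠ[𝓝 t] c₂} from fun t ht => (h ht).self_of_nhds
  refine hJc.isPreconnected.subset_of_closure_inter_subset isOpen_setOfPred_eventually_nhds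
    ⟨0, h0, ?_⟩ ?_
  · have hpos : c₁ 0 = c₂ 0 := congrArg Bundle.TotalSpace.proj hinit
    have hx := mem_chart_source E (c₁ 0)
    exact h₁.eventuallyEq_of_phaseCurve_eq h₂ hJ h0 hx (hpos ▸ hx)
      (phaseCurve_eq_of_velocity_eq (h₁.mdifferentiableAt hJ h0) (h₂.mdifferentiableAt hJ h0) hx
        hinit)
  · rintro t ⟨htu, ht⟩
    have hfreq := mem_closure_iff_frequently.mp htu
    have heq : c₁ t = c₂ t := tendsto_nhds_unique_of_frequently_eq
      (h₁.mdifferentiableAt hJ ht).continuousAt (h₂.mdifferentiableAt hJ ht).continuousAt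
      (hfreq.mono fun _ h => Filter.EventuallyEq.eq_of_nhds h)
    have hx₁ := mem_chart_source E (c₁ t)
    have hx₂ : c₂ t ∈ (chartAt E (c₁ t)).source := heq ▸ hx₁
    exact h₁.eventuallyEq_of_phaseCurve_eq h₂ hJ ht hx₁ hx₂
      (tendsto_nhds_unique_of_frequently_eq (h₁.hasDerivAt_phaseCurve hJ ht hx₁).continuousAt
        (h₂.hasDerivAt_phaseCurve hJ ht hx₂).continuousAt
        (hfreq.mono fun _ h => phaseCurve_eq_of_eventuallyEq h))

lemma GeodesicReaches.geodesicFamily_eq {p : TangentBundle 𝓘(ℝ, E) M} {s : ℝ} {y : M}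
    (h : GeodesicReaches cov p s y) : geodesicFamily cov p s = y := by
  have hex : ∃ y, GeodesicReaches cov p s y := ⟨y, h⟩
  rw [geodesicFamily, dif_pos hex]
  obtain ⟨c₁, J₁, hJ₁, hJc₁, h0₁, hs₁, hc₁, hp₁, hy₁⟩ := hex.choose_spec
  obtain ⟨c₂, J₂, hJ₂, hJc₂, h0₂, hs₂, hc₂, hp₂, hy₂⟩ := h
  rw [← hy₁, ← hy₂]
  exact (hc₁.mono Set.inter_subset_left).eqOn (hc₂.mono Set.inter_subset_right) (hJ₁.inter hJ₂)
    (hJc₁.inter hJc₂) ⟨h0₁, h0₂⟩ (hp₁.trans hp₂.symm) ⟨hs₁, hs₂⟩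

lemma isGeodesicOn_extChartAt_symm_comp {c : ℝ → E} {J : Set ℝ} (hJ : IsOpen J)
    (hc : ContDiffOn ℝ ∞ c J) (hcm : ∀ s ∈ J, c s ∈ (extChartAt 𝓘(ℝ, E) x₀).target)
    (hgeod : ∀ s ∈ J, connDeriv (connAlong (christoffel cov x₀) c) (deriv c) s = 0) :
    IsGeodesicOn cov (fun s => (extChartAt 𝓘(ℝ, E) x₀).symm (c s)) J := by
  have hsmooth := contMDiffOn_extChartAt_symm_comp hc hcm
  have hx : ∀ s ∈ J, (extChartAt 𝓘(ℝ, E) x₀).symm (c s) ∈ (chartAt E x₀).source := fun s hs =>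
    extChartAt_symm_mem_chart_source (hcm s hs)
  refine ⟨hsmooth, fun s hs => coordComponents_injective (hx s hs) ?_⟩
  have hright : ∀ s ∈ J, extChartAt 𝓘(ℝ, E) x₀ ((extChartAt 𝓘(ℝ, E) x₀).symm (c s)) = c s :=
    fun s hs => (extChartAt 𝓘(ℝ, E) x₀).right_inv (hcm s hs)
  have hderiv : Set.EqOn
      (deriv fun s => extChartAt 𝓘(ℝ, E) x₀ ((extChartAt 𝓘(ℝ, E) x₀).symm (c s))) (deriv c) J :=
    Set.EqOn.deriv hright hJ
  refine (eqOn_coordComponents_iterNabla cov hJ hsmooth hx 1 hs).trans ?_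
  rw [coordComponents_zero (hx s hs), ← hgeod s hs, Function.iterate_one,
    eqOn_connDeriv hJ hderiv hs]
  simp only [connDeriv, connAlong, hright s hs, hderiv hs]

lemma IsCoordGeodesicFamilyOn.geodesicReaches {g u : ℝ → E} {A : Set ℝ} {r : ℝ} {S V : ℝ × ℝ → E}
    (h : IsCoordGeodesicFamilyOn (christoffel cov x₀) (extChartAt 𝓘(ℝ, E) x₀).target g u A r S V)
    (hr : 0 < r) {q : ℝ × ℝ} (hq : q ∈ A ×ˢ Set.Ioo (-r) r) {p : TangentBundle 𝓘(ℝ, E) M}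
    (hp : p.1 ∈ (chartAt E x₀).source) (hpos : g q.1 = extChartAt 𝓘(ℝ, E) x₀ p.1)
    (hvel : u q.1 = coordComponents x₀ p.2) :
    GeodesicReaches cov p q.2 ((extChartAt 𝓘(ℝ, E) x₀).symm (S q)) := by
  have h0 : (0 : ℝ) ∈ Set.Ioo (-r) r := ⟨neg_lt_zero.mpr hr, hr⟩
  have hmem : ∀ s ∈ Set.Ioo (-r) r, S (q.1, s) ∈ (extChartAt 𝓘(ℝ, E) x₀).target := fun s hs =>
    h.position_mem (q.1, s) ⟨hq.1, hs⟩
  have hgeod : IsGeodesicOn cov (fun s => (extChartAt 𝓘(ℝ, E) x₀).symm (S (q.1, s)))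
      (Set.Ioo (-r) r) :=
    isGeodesicOn_extChartAt_symm_comp isOpen_Ioo (h.contDiffOn_position.comp
      (contDiff_prodMk_right q.1).contDiffOn fun s hs => ⟨hq.1, hs⟩) hmem
      fun s hs => h.connDeriv_eq_zero (q := (q.1, s)) ⟨hq.1, hs⟩
  refine ⟨_, Set.Ioo (-r) r, isOpen_Ioo, Set.ordConnected_Ioo, h0, hq.2, hgeod, ?_, rfl⟩
  have hx := extChartAt_symm_mem_chart_source (hmem 0 h0)
  refine tangentBundle_ext_of_coordComponents hx ?_ ?_
  · simp only [h.position_zero q.1 hq.1, hpos]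
    exact (extChartAt 𝓘(ℝ, E) x₀).left_inv (by rwa [extChartAt_source])
  · rw [← hvel, ← h.velocity_zero q.1 hq.1,
      coordComponents_velocity (hgeod.mdifferentiableAt isOpen_Ioo h0) hx]
    refine ((h.hasDerivAt_position (q.1, 0) ⟨hq.1, h0⟩).congr_of_eventuallyEq ?_).deriv
    exact Filter.eventually_of_mem (isOpen_Ioo.mem_nhds h0) fun s hs =>
      (extChartAt 𝓘(ℝ, E) x₀).right_inv (hmem s hs)

end Geodesics

/-! ### Frontals -/

section Frontal

lemma linearIndependent_iff_ιMulti_ne_zero {K N : Type*} [Field K] [AddCommGroup N] [Module K N]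
    {n : ℕ} {v : Fin n → N} : LinearIndependent K v ↔ ExteriorAlgebra.ιMulti K n v ≠ 0 := by
  refine ⟨fun hv h => ?_, not_imp_comm.mp (AlternatingMap.map_linearDependent _ _)⟩
  refine (exteriorPower.ιMulti_family_linearIndependent_field (n := n) hv).ne_zero
    (Set.powersetCard.ofFinEmbEquiv (RelEmbedding.refl _)) (Subtype.ext ?_)
  simpa [ExteriorAlgebra.ιMulti_family] using h

lemma ιMulti_pair_smul_add_smul {R N : Type*} [CommRing R] [AddCommGroup N] [Module R N] (a s : R)
    (v w : N) :
    ExteriorAlgebra.ιMulti R 2 ![a • w + s • v, w] = s • ExteriorAlgebra.ιMulti R 2 ![v, w] := by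
  simp [ExteriorAlgebra.ιMulti_apply, add_mul]

lemma map_eq_fst_smul_add_snd_smul {R N : Type*} [CommSemiring R] [AddCommMonoid N] [Module R N]
    (L : R × R →ₗ[R] N) (ξ : R × R) : L ξ = ξ.1 • L (1, 0) + ξ.2 • L (0, 1) := by
  rw [← map_smul, ← map_smul, ← map_add]
  simp

lemma map_mem_span_pair {R N : Type*} [CommSemiring R] [AddCommMonoid N] [Module R N]
    {L : R × R →ₗ[R] N} {a s : R} {v w : N} (ht : L (1, 0) = a • w + s • v) (hs : L (0, 1) = w)
    (ξ : R × R) : L ξ ∈ Submodule.span R {v, w} := by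
  refine Submodule.mem_span_pair.mpr ⟨ξ.1 * s, ξ.1 * a + ξ.2, ?_⟩
  rw [map_eq_fst_smul_add_snd_smul, ht, hs]
  module

lemma injective_iff_linearIndependent_pair {R N : Type*} [CommRing R] [AddCommGroup N] [Module R N]
    (L : R × R →ₗ[R] N) :
    Function.Injective L ↔ LinearIndependent R ![L (1, 0), L (0, 1)] := by
  rw [injective_iff_map_eq_zero, LinearIndependent.pair_iff, Prod.forall]
  refine forall₂_congr fun a b => ?_
  rw [map_eq_fst_smul_add_snd_smul, Prod.mk_eq_zero]

variable {E : Type*} [NormedAddCommGroup E] [NormedSpace ℝ E]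
  {M : Type*} [TopologicalSpace M] [ChartedSpace E M]

section Density

variable {f : ℝ × ℝ → M} {V₁ V₂ : ∀ q : ℝ × ℝ, TangentSpace 𝓘(ℝ, E) (f q)} {U : Set (ℝ × ℝ)}

lemma IsAreaDensityOn.mem_singularLocus_iff {σ : ℝ × ℝ → ℝ} (hσ : IsAreaDensityOn f V₁ V₂ σ U)
    {q : ℝ × ℝ} (hq : q ∈ U) (hV : LinearIndependent ℝ ![V₁ q, V₂ q]) :
    q ∈ singularLocus (E := E) f ↔ σ q = 0 := by
  change ¬ Function.Injective (surfaceDeriv f q).toLinearMap ↔ σ q = 0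
  rw [injective_iff_linearIndependent_pair, linearIndependent_iff_ιMulti_ne_zero, not_not]
  exact (congrArg (· = 0) (hσ q hq)).to_iff.trans
    (smul_eq_zero_iff_left (linearIndependent_iff_ιMulti_ne_zero.mp hV))

lemma isAreaDensityOn_snd_of_surfaceDeriv_eq {a : ℝ → ℝ}
    (hs : ∀ q ∈ U, surfaceDeriv f q (0, 1) = V₂ q)
    (ht : ∀ q ∈ U, surfaceDeriv f q (1, 0) = a q.1 • V₂ q + q.2 • V₁ q) :
    IsAreaDensityOn f V₁ V₂ Prod.snd U := fun q hq => by
  rw [hs q hq, ht q hq, ιMulti_pair_smul_add_smul]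

variable [IsManifold 𝓘(ℝ, E) ∞ M]

lemma isFrontal_and_singularLocus_of_isAreaDensityOn_snd (hU : IsOpen U)
    (hf : ContMDiffOn 𝓘(ℝ, ℝ × ℝ) 𝓘(ℝ, E) ∞ f U) (hV : IsIntegralFrameOn f V₁ V₂ U)
    (hσ : IsAreaDensityOn f V₁ V₂ Prod.snd U) {t₀ : ℝ} (ht₀ : (t₀, (0 : ℝ)) ∈ U) :
    IsFrontalWithNondegenerateSingularPointAt (E := E) f (t₀, 0) ∧
      singularLocus (E := E) f =ᶠ[𝓝 (t₀, (0 : ℝ))] {q : ℝ × ℝ | q.2 = 0} := by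
  refine ⟨⟨U, hU, ht₀, hf, V₁, V₂, hV, Prod.snd, contDiff_snd.contDiffOn, hσ, rfl, fun h => ?_⟩, ?_⟩
  · simpa [fderiv_snd] using DFunLike.congr_fun h ((0, 1) : ℝ × ℝ)
  · filter_upwards [hU.mem_nhds ht₀] with q hq
    exact propext (hσ.mem_singularLocus_iff hq (hV.linearIndependent q hq))

end Density

variable [IsManifold 𝓘(ℝ, E) ∞ M] {x₀ : M}

lemma mfderiv_eq_coordField {P : Type*} [NormedAddCommGroup P] [NormedSpace ℝ P] {f : P → M}
    {S : P → E} {Q : Set P} (hQ : IsOpen Q) (hS : ContDiffOn ℝ ∞ S Q)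
    (hSm : ∀ q ∈ Q, S q ∈ (extChartAt 𝓘(ℝ, E) x₀).target)
    (hf : Set.EqOn f (fun q => (extChartAt 𝓘(ℝ, E) x₀).symm (S q)) Q) {q : P} (hq : q ∈ Q) (ξ : P) :
    mfderiv 𝓘(ℝ, P) 𝓘(ℝ, E) f q ξ = coordField x₀ (fderiv ℝ S q ξ) (f q) := by
  have hx : f q ∈ (chartAt E x₀).source := hf hq ▸ extChartAt_symm_mem_chart_source (hSm q hq)
  have hfS : Set.EqOn (fun q => extChartAt 𝓘(ℝ, E) x₀ (f q)) S Q := fun q hq =>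
    (congrArg _ (hf hq)).trans ((extChartAt 𝓘(ℝ, E) x₀).right_inv (hSm q hq))
  have hmd : MDifferentiableAt 𝓘(ℝ, P) 𝓘(ℝ, E) f q :=
    (((contMDiffOn_extChartAt_symm_comp hS hSm).congr hf).contMDiffAt
      (hQ.mem_nhds hq)).mdifferentiableAt (by simp)
  rw [← (hfS.eventuallyEq_of_mem (hQ.mem_nhds hq)).fderiv_eq, ← coordComponents_mfderiv hmd hx ξ,
    coordField_coordComponents hx]

lemma isFrontal_and_singularLocus_of_fderiv_eq {f : ℝ × ℝ → M} {S V W : ℝ × ℝ → E} {a : ℝ → ℝ}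
    {Q : Set (ℝ × ℝ)} (hQ : IsOpen Q) (hS : ContDiffOn ℝ ∞ S Q) (hV : ContDiffOn ℝ ∞ V Q)
    (hW : ContDiffOn ℝ ∞ W Q) (hSm : ∀ q ∈ Q, S q ∈ (extChartAt 𝓘(ℝ, E) x₀).target)
    (hf : Set.EqOn f (fun q => (extChartAt 𝓘(ℝ, E) x₀).symm (S q)) Q)
    (hSs : ∀ q ∈ Q, fderiv ℝ S q (0, 1) = V q)
    (hSt : ∀ q ∈ Q, fderiv ℝ S q (1, 0) = a q.1 • V q + q.2 • W q)
    {t₀ : ℝ} (ht₀ : (t₀, (0 : ℝ)) ∈ Q) (hind : LinearIndependent ℝ ![W (t₀, 0), V (t₀, 0)]) :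
    IsFrontalWithNondegenerateSingularPointAt (E := E) f (t₀, 0) ∧
      singularLocus (E := E) f =ᶠ[𝓝 (t₀, (0 : ℝ))] {q : ℝ × ℝ | q.2 = 0} := by
  set U : Set (ℝ × ℝ) := Q ∩ (fun q => ![W q, V q]) ⁻¹' {b | LinearIndependent ℝ b}
  have hUQ : U ⊆ Q := Set.inter_subset_left
  have hU : IsOpen U :=
    ContinuousOn.isOpen_inter_preimage (continuousOn_pi.mpr <| Fin.forall_fin_two.mpr
      ⟨hW.continuousOn, hV.continuousOn⟩) hQ isOpen_setOfPred_linearIndependent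
  have hfU := ((contMDiffOn_extChartAt_symm_comp hS hSm).congr hf).mono hUQ
  have hx : ∀ q ∈ U, f q ∈ (chartAt E x₀).source := fun q hq =>
    hf (hUQ hq) ▸ extChartAt_symm_mem_chart_source (hSm q (hUQ hq))
  have hsmooth {Z : ℝ × ℝ → E} (hZ : ContDiffOn ℝ ∞ Z Q) :
      ContMDiffOn 𝓘(ℝ, ℝ × ℝ) 𝓘(ℝ, E).tangent ∞
        (fun q => (⟨f q, coordField x₀ (Z q) (f q)⟩ : TangentBundle 𝓘(ℝ, E) M)) U :=
    (contMDiffOn_tangentBundle_iff hx).mpr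
      ⟨hfU, (hZ.mono hUQ).congr fun q hq => coordComponents_coordField (hx q hq) _⟩
  have hlin : ∀ q ∈ U,
      LinearIndependent ℝ ![coordField x₀ (W q) (f q), coordField x₀ (V q) (f q)] := fun q hq => by
    rw [← linearIndependent_coordComponents_iff (hx q hq), coordComponents_coordField (hx q hq),
      coordComponents_coordField (hx q hq)]
    exact hq.2
  have hs : ∀ q ∈ U, surfaceDeriv f q (0, 1) = coordField x₀ (V q) (f q) := fun q hq => by
    rw [← hSs q (hUQ hq)]
    exact mfderiv_eq_coordField hQ hS hSm hf (hUQ hq) _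
  have ht : ∀ q ∈ U, surfaceDeriv f q (1, 0)
      = a q.1 • coordField x₀ (V q) (f q) + q.2 • coordField x₀ (W q) (f q) := fun q hq => by
    simp only [coordField_eq (hx q hq), ← map_smul, ← map_add]
    rw [← coordField_eq (hx q hq), ← hSt q (hUQ hq)]
    exact mfderiv_eq_coordField hQ hS hSm hf (hUQ hq) _
  refine isFrontal_and_singularLocus_of_isAreaDensityOn_snd hU hfU
    ⟨hsmooth hW, hsmooth hV, hlin, fun q hq => ?_⟩
    (isAreaDensityOn_snd_of_surfaceDeriv_eq hs ht) ⟨ht₀, hind⟩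
  exact map_mem_span_pair (L := (surfaceDeriv f q).toLinearMap) (ht q hq) (hs q hq)

end Frontal

/-! ### Tangent surfaces -/

section DirectedCurve

variable {E : Type*} [NormedAddCommGroup E] [NormedSpace ℝ E]
  {M : Type*} [TopologicalSpace M] [ChartedSpace E M] [IsManifold 𝓘(ℝ, E) ∞ M]
  {γ : ℝ → M} {x₀ : M} {A J : Set ℝ} {t₀ : ℝ} {m : ℕ} {v : ℝ → E}
  {u : ∀ t : ℝ, TangentSpace 𝓘(ℝ, E) (γ t)}

lemma IsDirectedFrameOn.mono (hu : IsDirectedFrameOn γ u J) (hA : A ⊆ J) :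
    IsDirectedFrameOn γ u A :=
  ⟨hu.smooth.mono hA, fun t ht => hu.ne_zero t (hA ht), fun t ht => hu.integral t (hA ht)⟩

lemma isDirectedFrameOn_coordField (hγ : ContMDiffOn 𝓘(ℝ, ℝ) 𝓘(ℝ, E) ∞ γ A)
    (hx : ∀ t ∈ A, γ t ∈ (chartAt E x₀).source) (hv : ContDiffOn ℝ ∞ v A)
    (hv₀ : ∀ t ∈ A, v t ≠ 0)
    (hvel : ∀ t ∈ A, ∃ a : ℝ, coordComponents x₀ (velocity γ t) = a • v t) :
    IsDirectedFrameOn γ (fun t => coordField x₀ (v t) (γ t)) A := by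
  have hcomp : ∀ t ∈ A, coordComponents x₀ (coordField x₀ (v t) (γ t)) = v t := fun t ht =>
    coordComponents_coordField (hx t ht) _
  refine ⟨(contMDiffOn_tangentBundle_iff hx).mpr ⟨hγ, hv.congr hcomp⟩, fun t ht h => ?_,
    fun t ht => ?_⟩
  · exact hv₀ t ht (by rw [← hcomp t ht, h, coordComponents_zero (hx t ht)])
  · obtain ⟨a, ha⟩ := hvel t ht
    exact ⟨a, coordComponents_injective (hx t ht) (by
      rw [ha, coordComponents_smul (hx t ht), hcomp t ht])⟩

lemma exists_isDirectedFrameOn (hA : IsOpen A) (ht₀ : t₀ ∈ A)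
    (hγ : ContMDiffOn 𝓘(ℝ, ℝ) 𝓘(ℝ, E) ∞ γ A) (hx : ∀ t ∈ A, γ t ∈ (chartAt E x₀).source)
    (hv : ContDiffOn ℝ ∞ v A) (hv₀ : v t₀ ≠ 0)
    (hvel : ∀ t ∈ A, ∃ a : ℝ, coordComponents x₀ (velocity γ t) = a • v t) :
    ∃ J : Set ℝ, IsOpen J ∧ J.OrdConnected ∧ t₀ ∈ J ∧ J ⊆ A ∧
      ∃ u : ∀ t : ℝ, TangentSpace 𝓘(ℝ, E) (γ t), IsDirectedFrameOn γ u J := by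
  have hopen : IsOpen (A ∩ v ⁻¹' {0}ᶜ) :=
    hv.continuousOn.isOpen_inter_preimage hA isOpen_compl_singleton
  obtain ⟨δ, hδ, hsub⟩ := Metric.isOpen_iff.mp hopen t₀ ⟨ht₀, hv₀⟩
  have hA' : Metric.ball t₀ δ ⊆ A := fun t ht => (hsub ht).1
  refine ⟨Metric.ball t₀ δ, Metric.isOpen_ball, (convex_ball t₀ δ).ordConnected,
    Metric.mem_ball_self hδ, hA', fun t => coordField x₀ (v t) (γ t), ?_⟩
  exact isDirectedFrameOn_coordField (hγ.mono hA') (fun t ht => hx t (hA' ht)) (hv.mono hA')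
    (fun t ht => (hsub ht).2) fun t ht => hvel t (hA' ht)

lemma IsDirectedFrameOn.exists_velocity_eq_smul {B : ℝ → E →L[ℝ] E}
    (hu : IsDirectedFrameOn γ u A) (hA : IsOpen A) (ht₀ : t₀ ∈ A)
    (hx : ∀ t ∈ A, γ t ∈ (chartAt E x₀).source) (hv : ContDiffOn ℝ ∞ v A)
    (hvel : ∀ t ∈ A, coordComponents x₀ (velocity γ t) = (t - t₀) ^ m • v t)
    (hind : LinearIndependent ℝ ![v t₀, connDeriv B v t₀]) :
    ∃ A' ⊆ A, IsOpen A' ∧ t₀ ∈ A' ∧ ∃ a : ℝ → ℝ, ContDiffOn ℝ ∞ a A' ∧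
      (∀ t ∈ A', velocity γ t = a t • u t) ∧
      LinearIndependent ℝ ![coordComponents x₀ (u t₀),
        connDeriv B (fun t => coordComponents x₀ (u t)) t₀] := by
  have hu₀ : coordComponents x₀ (u t₀) ≠ 0 := fun h => hu.ne_zero t₀ ht₀
    (coordComponents_injective (hx t₀ ht₀) (h.trans (coordComponents_zero (hx t₀ ht₀)).symm))
  have hprop : ∀ t ∈ A, ∃ b : ℝ,
      coordComponents x₀ (velocity γ t) = b • coordComponents x₀ (u t) := fun t ht => by
    obtain ⟨b, hb⟩ := hu.integral t ht
    exact ⟨b, by rw [hb, coordComponents_smul (hx t ht)]⟩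
  obtain ⟨A', hA'A, hA', ht₀', a, ha, hau, hindu⟩ := exists_contDiffOn_factor_of_pow_smul hA ht₀
    ((contMDiffOn_tangentBundle_iff hx).mp hu.smooth).2 hv hvel hu₀ hprop hind
  refine ⟨A', hA'A, hA', ht₀', a, ha, fun t ht => ?_, hindu⟩
  exact coordComponents_injective (hx t (hA'A ht))
    ((hau t ht).trans (coordComponents_smul (hx t (hA'A ht)) _ _).symm)

variable [FiniteDimensional ℝ E] [T2Space M] (cov : AffineConnection E M)
  [CovariantDerivative.ContMDiffCovariantDerivative cov ∞]

lemma exists_velocity_eq_pow_smul {r : ℝ} (hr : 0 < r)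
    (hγ : ContMDiffOn 𝓘(ℝ, ℝ) 𝓘(ℝ, E) ∞ γ (Metric.ball t₀ r))
    (hx : ∀ t ∈ Metric.ball t₀ r, γ t ∈ (chartAt E x₀).source)
    (hzero : ∀ i < m, iterNabla cov γ (i + 1) t₀ = 0)
    (hindep : LinearIndependent ℝ ![iterNabla cov γ (m + 1) t₀, iterNabla cov γ (m + 2) t₀]) :
    ∃ v : ℝ → E, ContDiffOn ℝ ∞ v (Metric.ball t₀ r) ∧
      (∀ t ∈ Metric.ball t₀ r, coordComponents x₀ (velocity γ t) = (t - t₀) ^ m • v t) ∧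
      LinearIndependent ℝ ![v t₀,
        connDeriv (connAlong (christoffel cov x₀) fun τ => extChartAt 𝓘(ℝ, E) x₀ (γ τ)) v t₀] := by
  have := FiniteDimensional.complete ℝ E
  have hA : IsOpen (Metric.ball t₀ r) := Metric.isOpen_ball
  have ht₀ : t₀ ∈ Metric.ball t₀ r := Metric.mem_ball_self hr
  have hB := contDiffOn_connAlong_christoffel cov hA hγ hx
  have hiter := eqOn_coordComponents_iterNabla cov hA hγ hx
  have hg' := ((contDiffOn_infty_iff_deriv_of_isOpen hA).mp (contDiffOn_extChartAt_comp hγ hx)).2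
  obtain ⟨v, hv, hgv⟩ := exists_eq_pow_smul_of_iterate_connDeriv_eq_zero hr hB hg' m
    fun i hi => by
      rw [← hiter i ht₀]
      simp only [hzero i hi, coordComponents_zero (hx t₀ ht₀)]
  refine ⟨v, hv, fun t ht => (hiter 0 ht).trans (hgv t ht), ?_⟩
  have hpow (j : ℕ) : coordComponents x₀ (iterNabla cov γ (m + j + 1) t₀)
      = ((m + j).descFactorial m : ℝ) • (connDeriv _)^[j] v t₀ :=
    (hiter (m + j) ht₀).trans ((eqOn_iterate_connDeriv hA hgv (m + j) ht₀).trans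
      (iterate_connDeriv_pow_smul_apply hA ht₀ hB hv m j))
  rw [← linearIndependent_coordComponents_iff (hx t₀ ht₀), hpow 0, hpow 1] at hindep
  exact linearIndependent_of_smul_of_smul_add (a := 0) (by simpa using hindep)

lemma isFrontal_and_singularLocus_tangentSurface (hA : IsOpen A) (ht₀ : t₀ ∈ A)
    (hx : ∀ t ∈ A, γ t ∈ (chartAt E x₀).source)
    (hu : ContMDiffOn 𝓘(ℝ, ℝ) 𝓘(ℝ, E).tangent ∞
      (fun t => (⟨γ t, u t⟩ : TangentBundle 𝓘(ℝ, E) M)) A)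
    {a : ℝ → ℝ} (ha : ContDiffOn ℝ ∞ a A) (hau : ∀ t ∈ A, velocity γ t = a t • u t)
    (hind : LinearIndependent ℝ ![coordComponents x₀ (u t₀),
      connDeriv (connAlong (christoffel cov x₀) fun τ => extChartAt 𝓘(ℝ, E) x₀ (γ τ))
        (fun t => coordComponents x₀ (u t)) t₀]) :
    IsFrontalWithNondegenerateSingularPointAt (E := E) (tangentSurface cov γ u) (t₀, 0) ∧
      singularLocus (E := E) (tangentSurface cov γ u)
        =ᶠ[𝓝 (t₀, (0 : ℝ))] {q : ℝ × ℝ | q.2 = 0} := by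
  have := FiniteDimensional.complete ℝ E
  obtain ⟨hγ, huc⟩ := (contMDiffOn_tangentBundle_iff hx).mp hu
  have hg₀ : extChartAt 𝓘(ℝ, E) x₀ (γ t₀) ∈ (extChartAt 𝓘(ℝ, E) x₀).target :=
    (extChartAt 𝓘(ℝ, E) x₀).map_source (by rw [extChartAt_source]; exact hx t₀ ht₀)
  obtain ⟨A', hA'A, hA', ht₀', r, hr, S, V, hSV⟩ := exists_isCoordGeodesicFamilyOn
    (isOpen_extChartAt_target x₀) (contDiffOn_christoffel cov x₀) hA ht₀
    (contDiffOn_extChartAt_comp hγ hx) hg₀ huc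
  have hga : ∀ t ∈ A', deriv (fun τ => extChartAt 𝓘(ℝ, E) x₀ (γ τ)) t
      = a t • coordComponents x₀ (u t) := fun t ht => by
    rw [← coordComponents_smul (hx t (hA'A ht)), ← hau t (hA'A ht), coordComponents_velocity
      ((hγ.contMDiffAt (hA.mem_nhds (hA'A ht))).mdifferentiableAt (by simp)) (hx t (hA'A ht))]
  obtain ⟨W, hW, hSW⟩ := hSV.exists_fderiv_horizontal_eq hA' hr (ha.mono hA'A) hga
  have hWV : LinearIndependent ℝ ![W (t₀, 0), V (t₀, 0)] := by
    rw [hSV.eq_connDeriv_of_fderiv_horizontal_eq hA' hr hga hW hSW ht₀', hSV.velocity_zero t₀ ht₀']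
    exact LinearIndependent.pair_symm_iff.mp hind
  exact isFrontal_and_singularLocus_of_fderiv_eq (hA'.prod isOpen_Ioo) hSV.contDiffOn_position
    hSV.contDiffOn_velocity hW hSV.position_mem
    (fun q hq => (hSV.geodesicReaches (p := ⟨γ q.1, u q.1⟩) hr hq (hx _ (hA'A hq.1)) rfl
      rfl).geodesicFamily_eq)
    (fun q hq => hSV.fderiv_position_vertical hA' hq) hSW ⟨ht₀', neg_lt_zero.mpr hr, hr⟩ hWV

end DirectedCurve

end TangentSurface

end

theorem lemma2p2 {E : Type*} [NormedAddCommGroup E] [NormedSpace ℝ E] [FiniteDimensional ℝ E]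
    {M : Type*} [TopologicalSpace M] [T2Space M] [ChartedSpace E M] [IsManifold 𝓘(ℝ, E) ∞ M]
    (cov : TangentSurface.AffineConnection E M) [CovariantDerivative.ContMDiffCovariantDerivative cov ∞]
    (I : Set ℝ) (hIopen : IsOpen I) (hI : I.OrdConnected)
    (γ : ℝ → M) (hγ : ContMDiffOn 𝓘(ℝ, ℝ) 𝓘(ℝ, E) ∞ γ I)
    (t₀ : ℝ) (ht₀ : t₀ ∈ I) (k : ℕ) (hk : 1 ≤ k)
    (hzero : ∀ i : ℕ, 1 ≤ i → i < k → TangentSurface.iterNabla cov γ i t₀ = 0)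
    (hindep : LinearIndependent ℝ
      ![TangentSurface.iterNabla cov γ k t₀, TangentSurface.iterNabla cov γ (k + 1) t₀]) :
    -- `γ` is directed near `t₀`, so that its tangent surface is defined as a germ at `(t₀, 0)`
    (∃ J : Set ℝ, IsOpen J ∧ J.OrdConnected ∧ t₀ ∈ J ∧ J ⊆ I ∧
      ∃ u : ∀ t : ℝ, TangentSpace 𝓘(ℝ, E) (γ t), TangentSurface.IsDirectedFrameOn γ u J) ∧
    -- and whatever frame is used to define it, the germ has the asserted properties
    (∀ J : Set ℝ, IsOpen J → t₀ ∈ J → J ⊆ I →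
      ∀ u : ∀ t : ℝ, TangentSpace 𝓘(ℝ, E) (γ t), TangentSurface.IsDirectedFrameOn γ u J →
        TangentSurface.IsFrontalWithNondegenerateSingularPointAt (E := E)
          (TangentSurface.tangentSurface cov γ u) (t₀, 0) ∧
        TangentSurface.singularLocus (E := E) (TangentSurface.tangentSurface cov γ u)
          =ᶠ[𝓝 (t₀, (0 : ℝ))] {q : ℝ × ℝ | q.2 = 0}) := by
  obtain ⟨m, rfl⟩ : ∃ m, k = m + 1 := ⟨k - 1, by omega⟩
  obtain ⟨r, hr, hsub⟩ := Metric.isOpen_iff.mp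
    (hγ.continuousOn.isOpen_inter_preimage hIopen (chartAt E (γ t₀)).open_source) t₀
    ⟨ht₀, mem_chart_source E (γ t₀)⟩
  have hγr := hγ.mono fun t ht => (hsub ht).1
  have hx : ∀ t ∈ Metric.ball t₀ r, γ t ∈ (chartAt E (γ t₀)).source := fun t ht => (hsub ht).2
  obtain ⟨v, hv, hvel, hind⟩ := TangentSurface.exists_velocity_eq_pow_smul cov hr hγr hx
    (fun i hi => hzero (i + 1) (by omega) (by omega)) hindep
  constructor
  · obtain ⟨J, hJ, hJc, ht₀J, hJr, u, hu⟩ := TangentSurface.exists_isDirectedFrameOn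
      Metric.isOpen_ball (Metric.mem_ball_self hr) hγr hx hv (hind.ne_zero 0)
      fun t ht => ⟨_, hvel t ht⟩
    exact ⟨J, hJ, hJc, ht₀J, fun t ht => (hsub (hJr ht)).1, u, hu⟩
  · intro J hJ ht₀J _ u hu
    have huJ := hu.mono (Set.inter_subset_right (s := Metric.ball t₀ r))
    obtain ⟨A, hAJ, hA, ht₀A, a, ha, hau, hindu⟩ := huJ.exists_velocity_eq_smul
      (Metric.isOpen_ball.inter hJ) ⟨Metric.mem_ball_self hr, ht₀J⟩ (fun t ht => hx t ht.1)
      (hv.mono Set.inter_subset_left) (fun t ht => hvel t ht.1) hind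
    exact TangentSurface.isFrontal_and_singularLocus_tangentSurface cov hA ht₀A
      (fun t ht => hx t (hAJ ht).1) (huJ.smooth.mono hAJ) ha hau hindu
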